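/- Let $(G^{(n)})_{n\ge 1}$ be a sequence of finite abelian groups (written multiplicatively) with $|G^{(n)}|\to\infty$, let $\alpha\in[0,1]$ and $\beta>0$. For each $n$ let $\{Y^{(n)}_a : a\in G^{(n)}\}$ be square-integrable complex random variables on a probability space (which may depend on $n$) that have mean $0$, satisfy $Y^{(n)}_{a^{-1}}=\overline{Y^{(n)}_a}$ almost surely for each $a$, and are independent except for this constraint (that is, each subfamily containing no two variables with distinct mutually inverse indices is independent). Suppose that for all $n$ and all $a,b\in G^{(n)}$ \[ \mathbb{E}\, Y_a^{(n)}Y_b^{(n)}=\begin{cases}1 & \text{if } a=b^{-1}\ne a^{-1},\\ \alpha & \text{if } a=b\neq a^{-1},\\ \beta & \text{if } a=b=a^{-1},\\ 0&\text{otherwise,}\end{cases} \] and that for every $\varepsilon>0$ \[ \lim_{n\to\infty}\frac1{|G^{(n)}|}\sum_{a\in G^{(n)}}\mathbb{E}\Bigl(|Y_a^{(n)}|^2\,\mathbf 1_{\{|Y_a^{(n)}|\ge\varepsilon\sqrt{|G^{(n)}|}\}}\Bigr)=0 . \] Suppose further that $p_2^{(n)}=|\{a\in G^{(n)}: a^2=1\}|/|G^{(n)}|$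 converges to a limit $p$. Let $\mu^{(n)}$ be the empirical spectral measure (the uniform average of point masses at the eigenvalues, counted with multiplicity) of the random matrix $M^{(n)}=\bigl[|G^{(n)}|^{-1/2}\,Y^{(n)}_{ab^{-1}}\bigr]_{a,b\in G^{(n)}}$. If $p<1$, then $1+p(\beta-\alpha-1)$ and $1+\alpha+p(\beta-\alpha-1)$ are positive, and $\mu^{(n)}$ converges weakly, in mean and in probability, to \[ (1-p)\,\mathcal N\bigl(0,\,1+p(\beta-\alpha-1)\bigr)+p\,\mathcal N\bigl(0,\,1+\alpha+p(\beta-\alpha-1)\bigr). \] If $p=1$, then $\mu^{(n)}$ converges weakly, in mean and in probability, to $\mathcal N(0,\beta)$. Here $\mathcal N(0,v)$ is the real normal distribution with mean $0$ and variance $v$, regarded as a measure on $\mathbb{C}$ carried by the real line; convergence of $\mu^{(n)}$ to $\nu$ in mean (in probability) means that for each bounded continuous $f:\mathbb{C}\to\mathbb{R}$ one has $\mathbb{E}\int f\,d\mu^{(n)}\to\int f\,d\nu$ (respectively $\int f\,d\mu^{(n)}\to\int f\,d\nu$ in probability). -/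

import Mathlib

open MeasureTheory ProbabilityTheory Filter Topology
open scoped BoundedContinuousFunction ComplexConjugate ENNReal

/-- The random `G`-circulant matrix `[|G|^{-1/2} y (a b⁻¹)]_{a,b ∈ G}` built from `y : G → ℂ`. -/
noncomputable def groupCirculant {G : Type*} [CommGroup G] [Fintype G] (y : G → ℂ) :
    Matrix G G ℂ :=
  Matrix.of fun a b => ((1 / √(Fintype.card G : ℝ) : ℝ) : ℂ) * y (a * b⁻¹)

/-- The empirical spectral measure of a square complex matrix: the average of the point masses
at its eigenvalues, counted with algebraic multiplicity. -/
noncomputable def empiricalSpectralMeasure {ι : Type*} [Fintype ι] [DecidableEq ι]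
    (M : Matrix ι ι ℂ) : Measure ℂ :=
  (Fintype.card ι : ℝ≥0∞)⁻¹ • (M.charpoly.roots.map fun z => Measure.dirac z).sum

/-- The fraction of elements `a` of a finite group with `a² = 1`. -/
noncomputable def involutionFraction (G : Type*) [CommGroup G] [Fintype G] [DecidableEq G] : ℝ :=
  ((Finset.univ.filter fun a : G => a ^ 2 = 1).card : ℝ) / (Fintype.card G : ℝ)

/-- The family `(Y a)_{a ∈ G}` is independent except for a constraint tying `Y a⁻¹` to `Y a`:
each subfamily that does not contain two distinct mutually inverse indices is independent. -/
def IndepUpToInverse {G Ω : Type*} [CommGroup G] [MeasurableSpace Ω]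
    (P : Measure Ω) (Y : G → Ω → ℂ) : Prop :=
  ∀ S : Set G, (∀ a ∈ S, a⁻¹ ∈ S → a⁻¹ = a) → iIndepFun (fun a : S => Y a) P

/-- The Lindeberg condition for a sequence of finite families of random variables. -/
def LindebergCondition {G Ω : ℕ → Type*} [∀ n, Fintype (G n)] [∀ n, MeasurableSpace (Ω n)]
    (P : ∀ n, Measure (Ω n)) (Y : ∀ n, G n → Ω n → ℂ) : Prop :=
  ∀ ε : ℝ, 0 < ε →
    Tendsto (fun n => (1 / (Fintype.card (G n) : ℝ)) *
        ∑ a : G n, ∫ ω, Set.indicator {ω | ε * √(Fintype.card (G n) : ℝ) ≤ ‖Y n a ω‖}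
          (fun ω => ‖Y n a ω‖ ^ 2) ω ∂(P n))
      atTop (𝓝 0)

/-- The random measures `μ n` converge weakly to `ν` in mean: `(𝔼 μ n)(f) = 𝔼 (μ n f) → ν f`
for each bounded continuous `f`. -/
def WeaklyConvergesInMean {Ω : ℕ → Type*} [∀ n, MeasurableSpace (Ω n)]
    (P : ∀ n, Measure (Ω n)) (μ : ∀ n, Ω n → Measure ℂ) (ν : Measure ℂ) : Prop :=
  ∀ f : ℂ →ᵇ ℝ, (∀ n, Integrable (fun ω => ∫ z, f z ∂(μ n ω)) (P n)) ∧
    Tendsto (fun n => ∫ ω, (∫ z, f z ∂(μ n ω)) ∂(P n)) atTop (𝓝 (∫ z, f z ∂ν))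

/-- The random measures `μ n` converge weakly to `ν` in probability: `μ n f → ν f` in
probability for each bounded continuous `f`. -/
def WeaklyConvergesInProbability {Ω : ℕ → Type*} [∀ n, MeasurableSpace (Ω n)]
    (P : ∀ n, Measure (Ω n)) (μ : ∀ n, Ω n → Measure ℂ) (ν : Measure ℂ) : Prop :=
  ∀ f : ℂ →ᵇ ℝ, ∀ ε : ℝ, 0 < ε →
    Tendsto (fun n => P n {ω | ε ≤ |(∫ z, f z ∂(μ n ω)) - ∫ z, f z ∂ν|}) atTop (𝓝 0)

/-- The centred real normal distribution with variance `v ≥ 0`, as a measure on `ℂ`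
carried by the real axis. -/
noncomputable def realNormal (v : ℝ) : Measure ℂ :=
  (gaussianReal 0 v.toNNReal).map Complex.ofReal

/-! The characters of G form a basis of eigenvectors of every G-circulant matrix. The spectrum
therefore consists of the numbers λ_χ = |G|^{-1/2} Σ_a χ(a) Y_a, which are almost surely real
because Y_{a⁻¹} is the conjugate of Y_a. Once a is grouped with a⁻¹, each combination sλ_χ + tλ_ψ is
a sum of independent terms. Lindeberg's argument (`norm_integral_exp_linear_sub_le`) then makes its
characteristic function nearly Gaussian, with an error uniform in χ and ψ.

Orthogonality of characters gives λ_χ the variance 1 + α·[χ² = 1] + (β - α - 1)p₂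
(`integral_realEigenvalue_sq`), and exactly a fraction p₂ of the characters satisfies χ² = 1
(`card_char_sq_trivial`). This is the origin of the two-component mixture. Individual covariances
need not be small, but Parseval and Cauchy-Schwarz bound Σ_ψ |cov(λ_χ, λ_ψ)| by O(√|G|)
(`sum_abs_integral_realEigenvalue_mul_le`), which is negligible after averaging over |G| characters.

Hence the joint characteristic function, averaged over all pairs (χ, ψ), tends to κ(s)κ(t), where κ
is the characteristic function of the limit ν. Lévy's theorem in the plane turns this into
𝔼[μ(f)μ(g)] → ν(f)ν(g). Taking g = 1 gives convergence in mean; taking f = g with ν(f) subtracted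
gives a vanishing second moment, hence convergence in probability.

Positivity of the variances rests on a gap: the solutions of a² = 1 form a subgroup, so p₂ is 1 or
at most 1/2, and p < 1 forces p ≤ 1/2. -/

/-! ### Elementary inequalities for exponentials and products -/

theorem norm_prod_sub_prod_le_sum {ι : Type*} (s : Finset ι) (u v : ι → ℂ)
    (hu : ∀ i ∈ s, ‖u i‖ ≤ 1) (hv : ∀ i ∈ s, ‖v i‖ ≤ 1) :
    ‖∏ i ∈ s, u i - ∏ i ∈ s, v i‖ ≤ ∑ i ∈ s, ‖u i - v i‖ := by
  classical
  induction s using Finset.induction_on with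
  | empty => simp
  | insert a s ha ih =>
    rw [Finset.prod_insert ha, Finset.prod_insert ha, Finset.sum_insert ha]
    have h1 : u a * ∏ i ∈ s, u i - v a * ∏ i ∈ s, v i =
        (u a - v a) * ∏ i ∈ s, u i + v a * (∏ i ∈ s, u i - ∏ i ∈ s, v i) := by ring
    have h2 : ‖∏ i ∈ s, u i‖ ≤ 1 := by
      rw [norm_prod]
      exact Finset.prod_le_one (fun _ _ => norm_nonneg _)
        fun i hi => hu i (Finset.mem_insert_of_mem hi)
    have h3 := ih (fun i hi => hu i (Finset.mem_insert_of_mem hi))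
      fun i hi => hv i (Finset.mem_insert_of_mem hi)
    have h4 := hv a (Finset.mem_insert_self _ _)
    rw [h1]
    refine (norm_add_le _ _).trans ?_
    rw [norm_mul, norm_mul]
    have := mul_le_mul_of_nonneg_left h2 (norm_nonneg (u a - v a))
    have := mul_le_mul h4 h3 (norm_nonneg _) zero_le_one
    linarith

/-- For |x| ≤ 1 the Taylor remainder is at most e|x|³, and |x|³ ≤ δx² when |x| < δ. For |x| ≥ 1 each
term is bounded separately by a multiple of x². The indicator part is what the Lindeberg condition
controls. -/
theorem norm_exp_mul_I_sub_taylor_le {δ : ℝ} (hδ : 0 < δ) (hδ1 : δ ≤ 1) (x : ℝ) :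
    ‖Complex.exp (x * Complex.I) - (1 + x * Complex.I - x ^ 2 / 2)‖ ≤
      3 * δ * x ^ 2 + 4 * Set.indicator {x : ℝ | δ ≤ |x|} (fun x => x ^ 2) x := by
  have hsmall : |x| ≤ 1 →
      ‖Complex.exp (x * Complex.I) - (1 + x * Complex.I - x ^ 2 / 2)‖ ≤ 3 * |x| ^ 3 := by
    intro hx
    have h := Complex.norm_exp_sub_sum_le_norm_mul_exp (x * Complex.I) 3
    have h1 : ∑ m ∈ Finset.range 3, ((x : ℂ) * Complex.I) ^ m / (m.factorial : ℂ) =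
        1 + x * Complex.I - x ^ 2 / 2 := by
      simp [Finset.sum_range_succ, Nat.factorial, mul_pow]
      ring
    rw [h1] at h
    have h2 : ‖(x : ℂ) * Complex.I‖ = |x| := by simp
    rw [h2] at h
    have h3 : Real.exp |x| ≤ 3 :=
      (Real.exp_le_exp.2 hx).trans (by linarith [Real.exp_one_lt_d9])
    have := mul_le_mul_of_nonneg_left h3 (pow_nonneg (abs_nonneg x) 3)
    linarith
  have hx2 : |x| ^ 2 = x ^ 2 := sq_abs x
  by_cases hx : δ ≤ |x|
  · rw [Set.indicator_of_mem (by exact hx)]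
    have hpos : 0 ≤ 3 * δ * x ^ 2 := by positivity
    suffices ‖Complex.exp (x * Complex.I) - (1 + x * Complex.I - x ^ 2 / 2)‖ ≤ 4 * x ^ 2 by
      linarith
    rcases le_total |x| 1 with h1 | h1
    · have := hsmall h1
      have h3 : |x| ^ 3 ≤ x ^ 2 := by
        rw [← hx2]; exact pow_le_pow_of_le_one (abs_nonneg x) h1 (by norm_num)
      nlinarith [sq_nonneg x]
    · have e1 : ‖Complex.exp (x * Complex.I)‖ = 1 := Complex.norm_exp_ofReal_mul_I x
      have e2 : ‖(1 + x * Complex.I - (x : ℂ) ^ 2 / 2)‖ ≤ 1 + |x| + x ^ 2 / 2 := by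
        refine (norm_sub_le _ _).trans ?_
        refine add_le_add ((norm_add_le _ _).trans ?_) ?_
        · simp
        · simp
      have := norm_sub_le (Complex.exp (x * Complex.I)) (1 + x * Complex.I - (x : ℂ) ^ 2 / 2)
      have h4 : 1 ≤ |x| ^ 2 := one_le_pow₀ h1
      have h5 : |x| ≤ |x| ^ 2 := by nlinarith
      rw [hx2] at h4 h5
      linarith
  · push Not at hx
    rw [Set.indicator_of_notMem (by simpa using hx)]
    have := hsmall (hx.le.trans hδ1)
    have h3 : |x| ^ 3 ≤ δ * x ^ 2 := by
      rw [← hx2, pow_succ']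
      exact mul_le_mul_of_nonneg_right hx.le (by positivity)
    linarith

theorem abs_exp_neg_sub_one_sub_le {x : ℝ} (hx : 0 ≤ x) :
    |Real.exp (-x) - (1 - x)| ≤ x ^ 2 := by
  rcases le_total x 1 with h | h
  · have := Real.abs_exp_sub_one_sub_id_le (x := -x) (by rwa [abs_neg, abs_of_nonneg hx])
    rw [neg_sq] at this
    convert this using 2
    ring
  · have h1 := Real.add_one_le_exp (-x)
    have h2 : Real.exp (-x) ≤ 1 := Real.exp_le_one_iff.2 (by linarith)
    rw [abs_of_nonneg (by linarith)]
    nlinarith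

theorem abs_exp_neg_sub_exp_neg_le {x y : ℝ} (hx : 0 ≤ x) (hy : 0 ≤ y) :
    |Real.exp (-x) - Real.exp (-y)| ≤ |x - y| := by
  wlog h : x ≤ y generalizing x y
  · rw [abs_sub_comm, abs_sub_comm x]
    exact this hy hx (by linarith)
  have h1 : Real.exp (-y) ≤ Real.exp (-x) := Real.exp_le_exp.2 (by linarith)
  have h2 : Real.exp (-y) = Real.exp (-x) * Real.exp (-(y - x)) := by
    rw [← Real.exp_add]; ring_nf
  have h3 := Real.add_one_le_exp (-(y - x))
  have h4 : Real.exp (-x) ≤ 1 := Real.exp_le_one_iff.2 (by linarith)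
  rw [abs_of_nonneg (by linarith), abs_of_nonpos (by linarith), h2]
  nlinarith [Real.exp_pos (-x)]

/-! ### Quantitative Lindeberg central limit theorem -/

section CLT
variable {Ω : Type*} [MeasurableSpace Ω] {P : Measure Ω} [IsProbabilityMeasure P]

theorem integrable_exp_mul_I {X : Ω → ℝ} (hX : AEStronglyMeasurable X P) :
    Integrable (fun ω => Complex.exp (X ω * Complex.I)) P := by
  refine Integrable.of_bound (C := 1) ?_ (ae_of_all _ fun ω => ?_)
  · exact (by fun_prop : Continuous fun x : ℝ => Complex.exp (x * Complex.I)).comp_aestronglyMeasurable hX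
  · rw [Complex.norm_exp_ofReal_mul_I]

theorem norm_integral_exp_mul_I_le_one (X : Ω → ℝ) :
    ‖∫ ω, Complex.exp (X ω * Complex.I) ∂P‖ ≤ 1 := by
  refine (norm_integral_le_integral_norm _).trans ?_
  simp [Complex.norm_exp_ofReal_mul_I]

omit [IsProbabilityMeasure P] in
theorem integrable_indicator_sq {Z : Ω → ℝ} (hZ : MemLp Z 2 P) (δ : ℝ) :
    Integrable (fun ω => Set.indicator {x : ℝ | δ ≤ |x|} (fun x => x ^ 2) (Z ω)) P := by
  refine hZ.integrable_sq.mono ?_ (ae_of_all _ fun ω => ?_)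
  · have hm : Measurable (Set.indicator {x : ℝ | δ ≤ |x|} (fun x => x ^ 2)) :=
      (by fun_prop : Measurable fun x : ℝ => x ^ 2).indicator
        (measurableSet_le measurable_const (by fun_prop))
    exact (hm.comp_aemeasurable hZ.aestronglyMeasurable.aemeasurable).aestronglyMeasurable
  · by_cases h : Z ω ∈ {x : ℝ | δ ≤ |x|}
    · rw [Set.indicator_of_mem h]
    · rw [Set.indicator_of_notMem h]; simp [sq_nonneg]

/-- A centred square-integrable variable has nearly the characteristic function of the
Gaussian of the same variance, at `1`. -/
theorem norm_integral_exp_sub_exp_variance_le {Z : Ω → ℝ} (hZ : MemLp Z 2 P)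
    (h0 : ∫ ω, Z ω ∂P = 0) {δ : ℝ} (hδ : 0 < δ) (hδ1 : δ ≤ 1) :
    ‖∫ ω, Complex.exp (Z ω * Complex.I) ∂P - Real.exp (-((∫ ω, Z ω ^ 2 ∂P) / 2))‖ ≤
      3 * δ * ∫ ω, Z ω ^ 2 ∂P +
      4 * ∫ ω, Set.indicator {x : ℝ | δ ≤ |x|} (fun x => x ^ 2) (Z ω) ∂P +
      (∫ ω, Z ω ^ 2 ∂P) ^ 2 := by
  have hi : Integrable Z P := hZ.integrable (by norm_num)
  have hi2 : Integrable (fun ω => Z ω ^ 2) P := hZ.integrable_sq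
  have hexp := integrable_exp_mul_I (P := P) hZ.aestronglyMeasurable
  have hiC : Integrable (fun ω => (Z ω : ℂ)) P := hi.ofReal
  have hi2C : Integrable (fun ω => (Z ω : ℂ) ^ 2) P := by
    simpa using hi2.ofReal (𝕜 := ℂ)
  have hc : ∫ ω, (Z ω : ℂ) ∂P = 0 := by
    rw [integral_complex_ofReal, h0]; simp
  have hc2 : ∫ ω, (Z ω : ℂ) ^ 2 ∂P = ((∫ ω, Z ω ^ 2 ∂P : ℝ) : ℂ) := by
    rw [← integral_complex_ofReal]; simp
  have hT : Integrable (fun ω => (1 + (Z ω : ℂ) * Complex.I - (Z ω : ℂ) ^ 2 / 2)) P :=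
    ((integrable_const _).add (hiC.mul_const _)).sub (hi2C.div_const _)
  have hTint : ∫ ω, (1 + (Z ω : ℂ) * Complex.I - (Z ω : ℂ) ^ 2 / 2) ∂P =
      1 - ((∫ ω, Z ω ^ 2 ∂P : ℝ) : ℂ) / 2 := by
    have hi1 : Integrable (fun ω => 1 + (Z ω : ℂ) * Complex.I) P :=
      (integrable_const _).add (hiC.mul_const _)
    rw [integral_sub hi1 (hi2C.div_const _),
      integral_add (integrable_const _) (hiC.mul_const _), integral_mul_const, integral_div,
      hc, hc2]
    simp
  have h1 : ‖∫ ω, Complex.exp (Z ω * Complex.I) ∂P - (1 - ((∫ ω, Z ω ^ 2 ∂P : ℝ) : ℂ) / 2)‖ ≤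
      3 * δ * ∫ ω, Z ω ^ 2 ∂P +
      4 * ∫ ω, Set.indicator {x : ℝ | δ ≤ |x|} (fun x => x ^ 2) (Z ω) ∂P := by
    rw [← hTint, ← integral_sub hexp hT, ← integral_const_mul, ← integral_const_mul,
      ← integral_add (hi2.const_mul _) ((integrable_indicator_sq hZ δ).const_mul _)]
    refine (norm_integral_le_integral_norm _).trans (integral_mono (hexp.sub hT).norm
      ((hi2.const_mul _).add ((integrable_indicator_sq hZ δ).const_mul _)) fun ω => ?_)
    exact norm_exp_mul_I_sub_taylor_le hδ hδ1 (Z ω)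
  have hσ : 0 ≤ ∫ ω, Z ω ^ 2 ∂P := integral_nonneg fun ω => sq_nonneg _
  set σ := ∫ ω, Z ω ^ 2 ∂P with hσdef
  have h2 := abs_exp_neg_sub_one_sub_le (x := σ / 2) (by positivity)
  have h3 : ‖((1 - (σ : ℂ) / 2) - Real.exp (-(σ / 2)))‖ ≤ σ ^ 2 := by
    have : ((1 - (σ : ℂ) / 2) - Real.exp (-(σ / 2))) =
        (((1 - σ / 2) - Real.exp (-(σ / 2)) : ℝ) : ℂ) := by push_cast; ring
    rw [this, Complex.norm_real, Real.norm_eq_abs, abs_sub_comm]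
    nlinarith
  calc _ = ‖(∫ ω, Complex.exp (Z ω * Complex.I) ∂P - (1 - (σ : ℂ) / 2)) +
        ((1 - (σ : ℂ) / 2) - Real.exp (-(σ / 2)))‖ := by congr 1; ring
    _ ≤ _ := (norm_add_le _ _).trans (add_le_add h1 h3)

/-- A quantitative form of Lindeberg's central limit theorem. -/
theorem norm_integral_exp_sum_sub_le {ι : Type*} [Fintype ι] {Z : ι → Ω → ℝ}
    (hZ : ∀ i, MemLp (Z i) 2 P) (h0 : ∀ i, ∫ ω, Z i ω ∂P = 0) (hind : iIndepFun Z P)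
    {δ : ℝ} (hδ : 0 < δ) (hδ1 : δ ≤ 1) :
    ‖∫ ω, Complex.exp ((∑ i, Z i ω : ℝ) * Complex.I) ∂P -
        Real.exp (-((∫ ω, (∑ i, Z i ω) ^ 2 ∂P) / 2))‖ ≤
      ∑ i, (3 * δ * ∫ ω, Z i ω ^ 2 ∂P +
        4 * ∫ ω, Set.indicator {x : ℝ | δ ≤ |x|} (fun x => x ^ 2) (Z i ω) ∂P +
        (∫ ω, Z i ω ^ 2 ∂P) ^ 2) := by
  have hm : ∀ i, AEMeasurable (Z i) P := fun i => (hZ i).aestronglyMeasurable.aemeasurable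
  have h1 : ∫ ω, Complex.exp ((∑ i, Z i ω : ℝ) * Complex.I) ∂P =
      ∏ i, ∫ ω, Complex.exp (Z i ω * Complex.I) ∂P := by
    have hg : Continuous fun x : ℝ => Complex.exp (x * Complex.I) := by fun_prop
    have hi : iIndepFun (fun i ω => Complex.exp (Z i ω * Complex.I)) P :=
      hind.comp (fun _ x => Complex.exp (x * Complex.I)) fun _ => hg.measurable
    rw [← hi.integral_fun_prod_eq_prod_integral fun i =>
      hg.comp_aestronglyMeasurable (hZ i).aestronglyMeasurable]
    congr with ω
    rw [← Complex.exp_sum]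
    congr 1
    push_cast
    rw [Finset.sum_mul]
  have hS0 : ∫ ω, (∑ i, Z i ω) ∂P = 0 := by
    rw [integral_finsetSum _ fun i _ => (hZ i).integrable (by norm_num)]
    simp [h0]
  have h2 : ∫ ω, (∑ i, Z i ω) ^ 2 ∂P = ∑ i, ∫ ω, Z i ω ^ 2 ∂P := by
    have hv := IndepFun.variance_sum (μ := P) (X := Z) (s := Finset.univ) (fun i _ => hZ i)
      fun i _ j _ hij => hind.indepFun hij
    have hsum : AEMeasurable (∑ i, Z i) P := Finset.aemeasurable_sum _ fun i _ => hm i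
    rw [variance_of_integral_eq_zero hsum (by simpa using hS0)] at hv
    simp only [Finset.sum_apply] at hv
    rw [hv]
    exact Finset.sum_congr rfl fun i _ => variance_of_integral_eq_zero (hm i) (h0 i)
  have h3 : ((Real.exp (-((∑ i, ∫ ω, Z i ω ^ 2 ∂P) / 2)) : ℝ) : ℂ) =
      ∏ i, ((Real.exp (-((∫ ω, Z i ω ^ 2 ∂P) / 2)) : ℝ) : ℂ) := by
    rw [← Complex.ofReal_prod, ← Real.exp_sum, Finset.sum_neg_distrib, Finset.sum_div]
  rw [h1, h2, h3]
  -- Both characteristic functions are now products of factors of modulus at most 1, so the factors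
  -- can be exchanged one at a time.
  refine (norm_prod_sub_prod_le_sum _ _ _ (fun i _ => norm_integral_exp_mul_I_le_one _)
    fun i _ => ?_).trans (Finset.sum_le_sum fun i _ =>
      norm_integral_exp_sub_exp_variance_le (hZ i) (h0 i) hδ hδ1)
  rw [Complex.norm_real, Real.norm_eq_abs, Real.abs_exp, Real.exp_le_one_iff]
  have : 0 ≤ ∫ ω, Z i ω ^ 2 ∂P := integral_nonneg fun ω => sq_nonneg _
  linarith
end CLT

/-! ### Characters, eigenvalues and elements of order at most two -/

section Fourier
variable {G : Type*} [CommGroup G] [Fintype G]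

theorem AddChar.sum_multiplicative_dual_eq_ite [DecidableEq G] (a : G) :
    ∑ χ : AddChar (Additive G) ℂ, χ (.ofMul a) = if a = 1 then (Fintype.card G : ℂ) else 0 := by
  rw [AddChar.sum_apply_eq_ite]
  simp [Fintype.card_additive]

theorem AddChar.sum_multiplicative_eq_ite (χ : AddChar (Additive G) ℂ) :
    ∑ a : G, χ (.ofMul a) = if χ = 0 then (Fintype.card G : ℂ) else 0 := by
  have := AddChar.sum_eq_ite χ
  rw [Fintype.card_additive] at this
  rw [← this]
  exact Equiv.sum_comp (Additive.ofMul (α := G)) fun a => χ a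

theorem card_addChar_additive : Fintype.card (AddChar (Additive G) ℂ) = Fintype.card G := by
  rw [AddChar.card_eq, Fintype.card_additive]

/-- The eigenvalue of `groupCirculant y` at the character `χ`. -/
noncomputable def circulantEigenvalue (y : G → ℂ) (χ : AddChar (Additive G) ℂ) : ℂ :=
  ((1 / √(Fintype.card G : ℝ) : ℝ) : ℂ) * ∑ a : G, χ (.ofMul a) * y a

/-- The characters diagonalise the matrix: Σ_b y(ab⁻¹)χ(b) = χ(a) Σ_c χ(c)⁻¹y(c). The inverse χ(c)⁻¹
accounts for `-χ`. -/
theorem groupCirculant_charpoly [DecidableEq G] (y : G → ℂ) :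
    (groupCirculant y).charpoly =
      ∏ χ : AddChar (Additive G) ℂ, (Polynomial.X - Polynomial.C (circulantEigenvalue y (-χ))) := by
  let b : Module.Basis (AddChar (Additive G) ℂ) ℂ (G → ℂ) := AddChar.complexBasis (Additive G)
  have hb : ∀ χ a, b χ a = χ (.ofMul a) := fun χ a =>
    congrFun (AddChar.complexBasis_apply χ) (.ofMul a)
  have h1 : ∀ χ, Matrix.toLin' (groupCirculant y) (b χ) = circulantEigenvalue y (-χ) • b χ := by
    intro χ
    ext a
    rw [Matrix.toLin'_apply, Matrix.mulVec, dotProduct, Pi.smul_apply, hb, smul_eq_mul,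
      circulantEigenvalue]
    simp only [groupCirculant, Matrix.of_apply, hb]
    rw [mul_assoc, Finset.sum_mul, Finset.mul_sum,
      -- Substitution b = ac⁻¹ for the column index.
      ← Equiv.sum_comp ((Equiv.inv G).trans (Equiv.mulLeft a))]
    refine Finset.sum_congr rfl fun c _ => ?_
    simp only [Equiv.trans_apply, Equiv.inv_apply, Equiv.coe_mulLeft, mul_inv_rev, inv_inv,
      AddChar.neg_apply, ofMul_mul, ofMul_inv, AddChar.map_add_eq_mul]
    rw [mul_comm c a⁻¹, mul_inv_cancel_left]
    ring
  have h2 : LinearMap.toMatrix b b (Matrix.toLin' (groupCirculant y)) =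
      Matrix.diagonal fun χ => circulantEigenvalue y (-χ) := by
    ext χ ψ
    rw [LinearMap.toMatrix_apply, h1, map_smul, Module.Basis.repr_self, Matrix.diagonal_apply]
    by_cases h : χ = ψ
    · subst h; simp
    · simp [h]
  rw [← Matrix.charpoly_toLin', ← LinearMap.charpoly_toMatrix _ b, h2, Matrix.charpoly_diagonal]

theorem integral_empiricalSpectralMeasure_groupCirculant [DecidableEq G] (y : G → ℂ) (f : ℂ → ℝ) :
    ∫ z, f z ∂(empiricalSpectralMeasure (groupCirculant y)) =
      (Fintype.card (AddChar (Additive G) ℂ) : ℝ)⁻¹ *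
        ∑ χ : AddChar (Additive G) ℂ, f (circulantEigenvalue y χ) := by
  have h1 : ((groupCirculant y).charpoly.roots.map fun z => Measure.dirac z).sum =
      ∑ χ : AddChar (Additive G) ℂ, Measure.dirac (circulantEigenvalue y χ) := by
    have h2 : ∏ χ : AddChar (Additive G) ℂ,
        (Polynomial.X - Polynomial.C (circulantEigenvalue y (-χ))) =
        ((Finset.univ.val.map fun χ : AddChar (Additive G) ℂ => circulantEigenvalue y (-χ)).map
          fun z => Polynomial.X - Polynomial.C z).prod := by
      rw [Multiset.map_map]; rfl
    -- Negation permutes the dual group, so the sign in `-χ` disappears from the multiset of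
    -- eigenvalues.
    rw [groupCirculant_charpoly, h2, Polynomial.roots_multiset_prod_X_sub_C, Multiset.map_map,
      ← Equiv.sum_comp (Equiv.neg (AddChar (Additive G) ℂ))]
    rfl
  rw [empiricalSpectralMeasure, h1, integral_smul_measure, integral_finsetSum_measure]
  · rw [card_addChar_additive]
    simp
  · intro χ _
    exact integrable_dirac (by simp)

theorem conj_char_ofMul (χ : AddChar (Additive G) ℂ) (a : G) :
    conj (χ (.ofMul a)) = χ (.ofMul a⁻¹) := by
  rw [ofMul_inv, AddChar.map_neg_eq_conj]

theorem circulantEigenvalue_ofReal_re {y : G → ℂ} (hy : ∀ a, y a⁻¹ = conj (y a))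
    (χ : AddChar (Additive G) ℂ) :
    ((circulantEigenvalue y χ).re : ℂ) = circulantEigenvalue y χ := by
  rw [← Complex.conj_eq_iff_re, circulantEigenvalue, map_mul, Complex.conj_ofReal, map_sum,
    ← Equiv.sum_comp (Equiv.inv G)]
  simp_rw [map_mul, Equiv.inv_apply, hy, conj_char_ofMul, inv_inv, Complex.conj_conj]

theorem involutionFraction_nonneg (G : Type*) [CommGroup G] [Fintype G] [DecidableEq G] :
    0 ≤ involutionFraction G := by
  unfold involutionFraction; positivity

/-- The set in question is the kernel of squaring, so by Lagrange the fraction is 1/k with k the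
index of a subgroup. -/
theorem involutionFraction_eq_one_or_le_half (G : Type*) [CommGroup G] [Fintype G]
    [DecidableEq G] : involutionFraction G = 1 ∨ involutionFraction G ≤ 1 / 2 := by
  have hcard : (Finset.univ.filter fun a : G => a ^ 2 = 1).card =
      Nat.card (powMonoidHom 2 : G →* G).ker := by
    rw [← Fintype.card_subtype, ← Nat.card_eq_fintype_card]
    exact Nat.card_congr (Equiv.subtypeEquivRight fun a => by simp [MonoidHom.mem_ker])
  have hdvd : (Finset.univ.filter fun a : G => a ^ 2 = 1).card ∣ Fintype.card G := by
    rw [hcard, ← Nat.card_eq_fintype_card]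
    exact Subgroup.card_subgroup_dvd_card _
  obtain ⟨k, hk⟩ := hdvd
  have hpos : 0 < Fintype.card G := Fintype.card_pos
  unfold involutionFraction
  rw [hk] at hpos ⊢
  have hm : 0 < (Finset.univ.filter fun a : G => a ^ 2 = 1).card := Nat.pos_of_mul_pos_right hpos
  have hk0 : 0 < k := Nat.pos_of_mul_pos_left hpos
  have hm' : (0 : ℝ) < (Finset.univ.filter fun a : G => a ^ 2 = 1).card := by exact_mod_cast hm
  rw [Nat.cast_mul, div_mul_cancel_left₀ hm'.ne']
  rcases Nat.lt_or_ge k 2 with h | h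
  · left
    have : k = 1 := by omega
    simp [this]
  · right
    rw [one_div]
    exact inv_anti₀ (by norm_num) (by exact_mod_cast h)

/-- Double counting of Σ_χ Σ_a χ(a²): summing over a first counts the χ with χ² = 1, summing over χ
first counts the a with a² = 1, each with weight |G|. -/
theorem card_char_sq_trivial (G : Type*) [CommGroup G] [Fintype G] [DecidableEq G] :
    ((Finset.univ.filter fun χ : AddChar (Additive G) ℂ => χ + χ = 0).card : ℝ) =
      Fintype.card G * involutionFraction G := by
  have h : ∑ χ : AddChar (Additive G) ℂ, ∑ a : G, (χ + χ) (.ofMul a) =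
      ∑ a : G, ∑ χ : AddChar (Additive G) ℂ, χ (.ofMul (a ^ 2)) := by
    rw [Finset.sum_comm]
    refine Finset.sum_congr rfl fun a _ => Finset.sum_congr rfl fun χ _ => ?_
    rw [AddChar.add_apply, sq, ofMul_mul, AddChar.map_add_eq_mul]
  simp_rw [AddChar.sum_multiplicative_eq_ite, AddChar.sum_multiplicative_dual_eq_ite,
    Finset.sum_ite, Finset.sum_const_zero, add_zero, Finset.sum_const, nsmul_eq_mul] at h
  have hN : (Fintype.card G : ℂ) ≠ 0 := Nat.cast_ne_zero.2 Fintype.card_ne_zero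
  have h2 := mul_right_cancel₀ hN h
  have hN' : (Fintype.card G : ℝ) ≠ 0 := Nat.cast_ne_zero.2 Fintype.card_ne_zero
  rw [involutionFraction, mul_div_cancel₀ _ hN']
  exact_mod_cast h2

/-- Parseval's identity for the sums of the characters over a set, with Cauchy-Schwarz. -/
theorem sum_norm_sum_char_le [DecidableEq G] (S : Finset G) :
    ∑ χ : AddChar (Additive G) ℂ, ‖∑ a ∈ S, χ (.ofMul a)‖ ≤
      Fintype.card G * √(Fintype.card G : ℝ) := by
  have h1 : ∑ χ : AddChar (Additive G) ℂ, ‖∑ a ∈ S, χ (.ofMul a)‖ ^ 2 =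
      Fintype.card G * S.card := by
    have : ∀ χ : AddChar (Additive G) ℂ, ((‖∑ a ∈ S, χ (.ofMul a)‖ ^ 2 : ℝ) : ℂ) =
        ∑ a ∈ S, ∑ b ∈ S, χ (.ofMul (a * b⁻¹)) := by
      intro χ
      rw [Complex.ofReal_pow, ← Complex.mul_conj', map_sum, Finset.sum_mul_sum]
      simp_rw [conj_char_ofMul, ofMul_mul, AddChar.map_add_eq_mul]
    rw [← Complex.ofReal_inj, Complex.ofReal_sum]
    simp_rw [this]
    rw [Finset.sum_comm]
    have h3 : ∀ a ∈ S, ∑ χ : AddChar (Additive G) ℂ, ∑ b ∈ S, χ (.ofMul (a * b⁻¹)) =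
        Fintype.card G := by
      intro a ha
      rw [Finset.sum_comm]
      simp_rw [AddChar.sum_multiplicative_dual_eq_ite, mul_inv_eq_one]
      rw [Finset.sum_ite_eq, if_pos ha]
    rw [Finset.sum_congr rfl h3]
    simp [mul_comm]
  have h2 := sq_sum_le_card_mul_sum_sq (s := Finset.univ)
    (f := fun χ : AddChar (Additive G) ℂ => ‖∑ a ∈ S, χ (.ofMul a)‖)
  rw [h1, Finset.card_univ, card_addChar_additive] at h2
  refine le_trans (Real.le_sqrt_of_sq_le h2) ?_
  have h3 : (S.card : ℝ) ≤ Fintype.card G := by exact_mod_cast Finset.card_le_univ _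
  refine Real.sqrt_le_iff.2 ⟨by positivity, ?_⟩
  rw [mul_pow, Real.sq_sqrt (by positivity)]
  have : (0 : ℝ) ≤ Fintype.card G := by positivity
  nlinarith [mul_le_mul_of_nonneg_left h3 (mul_nonneg this this)]
end Fourier

/-! ### The averaged law of a pair of eigenvalues -/

section Levy

/-- The mean of the product of the empirical measure of the real random variables `L i` with
itself. -/
noncomputable def pairLaw {Ω ι : Type*} [MeasurableSpace Ω] [Fintype ι] (P : Measure Ω)
    (L : ι → Ω → ℝ) : Measure (WithLp 2 (ℝ × ℝ)) :=
  ((Fintype.card ι : ℝ≥0∞)⁻¹ * (Fintype.card ι : ℝ≥0∞)⁻¹) •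
    ∑ i, ∑ j, P.map fun ω => WithLp.toLp 2 (L i ω, L j ω)

variable {Ω ι : Type*} [MeasurableSpace Ω] [Fintype ι] {P : Measure Ω} [IsProbabilityMeasure P]
  {L : ι → Ω → ℝ}

theorem isProbabilityMeasure_pairLaw [Nonempty ι] (hL : ∀ i, AEMeasurable (L i) P) :
    IsProbabilityMeasure (pairLaw P L) := by
  have hm : ∀ i j, AEMeasurable (fun ω => WithLp.toLp 2 (L i ω, L j ω)) P := fun i j =>
    (WithLp.measurable_toLp 2 (ℝ × ℝ)).comp_aemeasurable ((hL i).prodMk (hL j))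
  refine ⟨?_⟩
  rw [pairLaw, Measure.smul_apply, Measure.finsetSum_apply]
  simp_rw [Measure.finsetSum_apply, Measure.map_apply_of_aemeasurable (hm _ _) MeasurableSet.univ]
  simp only [Set.preimage_univ, measure_univ, Finset.sum_const, Finset.card_univ, nsmul_eq_mul,
    mul_one, smul_eq_mul]
  have h0 : (Fintype.card ι : ℝ≥0∞) ≠ 0 := Nat.cast_ne_zero.2 Fintype.card_ne_zero
  have ht : (Fintype.card ι : ℝ≥0∞) ≠ ⊤ := ENNReal.natCast_ne_top _
  rw [mul_assoc, ← mul_assoc _ (Fintype.card ι : ℝ≥0∞), ENNReal.inv_mul_cancel h0 ht, one_mul,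
    ENNReal.inv_mul_cancel h0 ht]

theorem integral_pairLaw {E : Type*} [NormedAddCommGroup E] [NormedSpace ℝ E]
    (hL : ∀ i, AEMeasurable (L i) P) {F : WithLp 2 (ℝ × ℝ) → E}
    (hF : Continuous F) {C : ℝ} (hC : ∀ x, ‖F x‖ ≤ C) :
    ∫ x, F x ∂(pairLaw P L) = ((Fintype.card ι : ℝ)⁻¹ * (Fintype.card ι : ℝ)⁻¹) •
      ∑ i, ∑ j, ∫ ω, F (WithLp.toLp 2 (L i ω, L j ω)) ∂P := by
  have hm : ∀ i j, AEMeasurable (fun ω => WithLp.toLp 2 (L i ω, L j ω)) P := fun i j =>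
    (WithLp.measurable_toLp 2 (ℝ × ℝ)).comp_aemeasurable ((hL i).prodMk (hL j))
  have hint : ∀ i j, Integrable F (P.map fun ω => WithLp.toLp 2 (L i ω, L j ω)) := fun i j => by
    have := Measure.isProbabilityMeasure_map (hm i j)
    exact Integrable.of_bound hF.aestronglyMeasurable C (ae_of_all _ hC)
  rw [pairLaw, integral_smul_measure, integral_finsetSum_measure]
  · congr 1
    · simp
    · refine Finset.sum_congr rfl fun i _ => ?_
      rw [integral_finsetSum_measure fun j _ => hint i j]
      exact Finset.sum_congr rfl fun j _ => integral_map (hm i j) hF.aestronglyMeasurable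
  · intro i _
    exact integrable_finsetSum_measure.2 fun j _ => hint i j

theorem charFun_pairLaw (hL : ∀ i, AEMeasurable (L i) P) (t : WithLp 2 (ℝ × ℝ)) :
    charFun (pairLaw P L) t = ((Fintype.card ι : ℝ)⁻¹ * (Fintype.card ι : ℝ)⁻¹) •
      ∑ i, ∑ j, ∫ ω, Complex.exp ((t.fst * L i ω + t.snd * L j ω : ℝ) * Complex.I) ∂P := by
  rw [charFun_apply, integral_pairLaw hL (C := 1) (by fun_prop)
    fun x => (Complex.norm_exp_ofReal_mul_I _).le]
  congr! 7

theorem integral_bounded_pairLaw (hL : ∀ i, AEMeasurable (L i) P) (f g : ℝ →ᵇ ℝ) :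
    ∫ x, f x.fst * g x.snd ∂(pairLaw P L) =
      ∫ ω, ((Fintype.card ι : ℝ)⁻¹ * ∑ i, f (L i ω)) *
        ((Fintype.card ι : ℝ)⁻¹ * ∑ i, g (L i ω)) ∂P := by
  have hint : ∀ i j, Integrable (fun ω => f (L i ω) * g (L j ω)) P := fun i j => by
    refine Integrable.of_bound (C := ‖f‖ * ‖g‖) ?_ (ae_of_all _ fun ω => ?_)
    · exact ((f.continuous.measurable.comp_aemeasurable (hL i)).mul
        (g.continuous.measurable.comp_aemeasurable (hL j))).aestronglyMeasurable
    · rw [norm_mul]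
      exact mul_le_mul (f.norm_coe_le_norm _) (g.norm_coe_le_norm _) (norm_nonneg _) (norm_nonneg _)
  rw [integral_pairLaw hL (C := ‖f‖ * ‖g‖) (by fun_prop) fun x => ?_]
  · have h1 : ∀ i, ∑ j, ∫ ω, f (L i ω) * g (L j ω) ∂P = ∫ ω, ∑ j, f (L i ω) * g (L j ω) ∂P :=
      fun i => (integral_finsetSum _ fun j _ => hint i j).symm
    change _ • ∑ i, ∑ j, ∫ ω, f (L i ω) * g (L j ω) ∂P = _
    simp_rw [h1]
    rw [← integral_finsetSum _ fun i _ => integrable_finsetSum _ fun j _ => hint i j, smul_eq_mul,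
      ← integral_const_mul]
    congr with ω
    rw [mul_mul_mul_comm, Finset.sum_mul_sum]
  · rw [norm_mul]
    exact mul_le_mul (f.norm_coe_le_norm _) (g.norm_coe_le_norm _) (norm_nonneg _) (norm_nonneg _)

end Levy

/-! ### From pair characteristic functions to convergence of empirical measures -/

section Convergence
variable {Ω ι : ℕ → Type*} [∀ n, MeasurableSpace (Ω n)] [∀ n, Fintype (ι n)] [∀ n, Nonempty (ι n)]
  {P : ∀ n, Measure (Ω n)} [∀ n, IsProbabilityMeasure (P n)] {L : ∀ n, ι n → Ω n → ℝ}
  {ν : Measure ℝ} [IsProbabilityMeasure ν]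

/-- Lévy's continuity theorem for empirical measures: convergence of the averaged joint
characteristic functions of pairs to a product. -/
theorem tendsto_integral_mul_of_tendsto_pair_charFun (hL : ∀ n i, AEMeasurable (L n i) (P n))
    (h : ∀ s t : ℝ, Tendsto (fun n => ((Fintype.card (ι n) : ℝ)⁻¹ * (Fintype.card (ι n) : ℝ)⁻¹) •
      ∑ i, ∑ j, ∫ ω, Complex.exp ((s * L n i ω + t * L n j ω : ℝ) * Complex.I) ∂(P n)) atTop
      (𝓝 (charFun ν s * charFun ν t))) (f g : ℝ →ᵇ ℝ) :
    Tendsto (fun n => ∫ ω, ((Fintype.card (ι n) : ℝ)⁻¹ * ∑ i, f (L n i ω)) *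
        ((Fintype.card (ι n) : ℝ)⁻¹ * ∑ i, g (L n i ω)) ∂(P n)) atTop
      (𝓝 ((∫ x, f x ∂ν) * ∫ x, g x ∂ν)) := by
  have hm : Measurable (WithLp.toLp 2 : ℝ × ℝ → WithLp 2 (ℝ × ℝ)) :=
    WithLp.measurable_toLp 2 (ℝ × ℝ)
  let Q : ℕ → ProbabilityMeasure (WithLp 2 (ℝ × ℝ)) :=
    fun n => ⟨pairLaw (P n) (L n), isProbabilityMeasure_pairLaw (hL n)⟩
  let Q₀ : ProbabilityMeasure (WithLp 2 (ℝ × ℝ)) :=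
    ⟨(ν.prod ν).map (WithLp.toLp 2), Measure.isProbabilityMeasure_map hm.aemeasurable⟩
  have hQ : Tendsto Q atTop (𝓝 Q₀) := by
    refine ProbabilityMeasure.tendsto_of_tendsto_charFun fun t => ?_
    change Tendsto (fun n => charFun (pairLaw (P n) (L n)) t) atTop
      (𝓝 (charFun ((ν.prod ν).map (WithLp.toLp 2)) t))
    rw [charFun_prod]
    simp_rw [charFun_pairLaw (hL _)]
    exact h _ _
  let F : WithLp 2 (ℝ × ℝ) →ᵇ ℝ :=
    f.compContinuous ⟨fun x => x.fst, by fun_prop⟩ * g.compContinuous ⟨fun x => x.snd, by fun_prop⟩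
  have hF := (ProbabilityMeasure.tendsto_iff_forall_integral_tendsto.1 hQ) F
  have e1 : ∫ x, F x ∂(Q₀ : Measure (WithLp 2 (ℝ × ℝ))) = (∫ x, f x ∂ν) * ∫ x, g x ∂ν := by
    change ∫ x, F x ∂((ν.prod ν).map (WithLp.toLp 2)) = _
    rw [integral_map hm.aemeasurable F.continuous.aestronglyMeasurable]
    exact integral_prod_mul (μ := ν) (ν := ν) f g
  rw [e1] at hF
  refine hF.congr fun n => ?_
  exact integral_bounded_pairLaw (hL n) f g

theorem tendsto_integral_of_tendsto_pair_charFun (hL : ∀ n i, AEMeasurable (L n i) (P n))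
    (h : ∀ s t : ℝ, Tendsto (fun n => ((Fintype.card (ι n) : ℝ)⁻¹ * (Fintype.card (ι n) : ℝ)⁻¹) •
      ∑ i, ∑ j, ∫ ω, Complex.exp ((s * L n i ω + t * L n j ω : ℝ) * Complex.I) ∂(P n)) atTop
      (𝓝 (charFun ν s * charFun ν t))) (f : ℝ →ᵇ ℝ) :
    Tendsto (fun n => ∫ ω, ((Fintype.card (ι n) : ℝ)⁻¹ * ∑ i, f (L n i ω)) ∂(P n)) atTop
      (𝓝 (∫ x, f x ∂ν)) := by
  simpa using tendsto_integral_mul_of_tendsto_pair_charFun hL h f 1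

theorem tendsto_integral_sq_of_tendsto_pair_charFun (hL : ∀ n i, AEMeasurable (L n i) (P n))
    (h : ∀ s t : ℝ, Tendsto (fun n => ((Fintype.card (ι n) : ℝ)⁻¹ * (Fintype.card (ι n) : ℝ)⁻¹) •
      ∑ i, ∑ j, ∫ ω, Complex.exp ((s * L n i ω + t * L n j ω : ℝ) * Complex.I) ∂(P n)) atTop
      (𝓝 (charFun ν s * charFun ν t))) (f : ℝ →ᵇ ℝ) :
    Tendsto (fun n => ∫ ω, ((Fintype.card (ι n) : ℝ)⁻¹ * ∑ i, f (L n i ω) - ∫ x, f x ∂ν) ^ 2 ∂(P n))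
      atTop (𝓝 0) := by
  have h1 := tendsto_integral_mul_of_tendsto_pair_charFun hL h
    -- Both test functions are f centred under ν, so the limiting product of integrals is 0.
    (f - BoundedContinuousFunction.const ℝ (∫ x, f x ∂ν))
    (f - BoundedContinuousFunction.const ℝ (∫ x, f x ∂ν))
  have h2 : ∫ x, (f - BoundedContinuousFunction.const ℝ (∫ x, f x ∂ν)) x ∂ν = 0 := by
    simp only [BoundedContinuousFunction.coe_sub, Pi.sub_apply,
      BoundedContinuousFunction.const_apply]
    rw [integral_sub (f.integrable ν) (integrable_const _)]
    simp
  rw [h2, zero_mul] at h1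
  refine h1.congr fun n => ?_
  congr with ω
  simp only [BoundedContinuousFunction.coe_sub, Pi.sub_apply,
    BoundedContinuousFunction.const_apply, Finset.sum_sub_distrib, Finset.sum_const,
    Finset.card_univ, nsmul_eq_mul, mul_sub]
  rw [inv_mul_cancel_left₀ (Nat.cast_ne_zero.2 Fintype.card_ne_zero), sq, mul_sub]

/-- The empirical averages converge in probability, by Chebyshev's inequality. -/
theorem tendsto_measure_of_tendsto_pair_charFun (hL : ∀ n i, AEMeasurable (L n i) (P n))
    (h : ∀ s t : ℝ, Tendsto (fun n => ((Fintype.card (ι n) : ℝ)⁻¹ * (Fintype.card (ι n) : ℝ)⁻¹) •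
      ∑ i, ∑ j, ∫ ω, Complex.exp ((s * L n i ω + t * L n j ω : ℝ) * Complex.I) ∂(P n)) atTop
      (𝓝 (charFun ν s * charFun ν t))) (f : ℝ →ᵇ ℝ) {ε : ℝ} (hε : 0 < ε) :
    Tendsto (fun n => P n {ω | ε ≤ |(Fintype.card (ι n) : ℝ)⁻¹ * ∑ i, f (L n i ω) - ∫ x, f x ∂ν|})
      atTop (𝓝 0) := by
  have h1 := tendsto_integral_sq_of_tendsto_pair_charFun hL h f
  have h2 : Tendsto (fun n => ENNReal.ofReal ((∫ ω, ((Fintype.card (ι n) : ℝ)⁻¹ *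
      ∑ i, f (L n i ω) - ∫ x, f x ∂ν) ^ 2 ∂(P n)) / ε ^ 2)) atTop (𝓝 0) := by
    simpa using ENNReal.tendsto_ofReal (h1.div_const (ε ^ 2))
  refine tendsto_of_tendsto_of_tendsto_of_le_of_le tendsto_const_nhds h2 (fun _ => zero_le)
    fun n => ?_
  have hint : Integrable (fun ω => ((Fintype.card (ι n) : ℝ)⁻¹ *
      ∑ i, f (L n i ω) - ∫ x, f x ∂ν) ^ 2) (P n) := by
    have hm : AEMeasurable (fun ω => (Fintype.card (ι n) : ℝ)⁻¹ *
        ∑ i, f (L n i ω) - ∫ x, f x ∂ν) (P n) :=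
      ((Finset.aemeasurable_fun_sum _ fun i _ =>
        f.continuous.measurable.comp_aemeasurable (hL n i)).const_mul _).sub_const _
    refine Integrable.of_bound (C := (‖f‖ + ‖∫ x, f x ∂ν‖) ^ 2) (hm.pow_const 2).aestronglyMeasurable
      (ae_of_all _ fun ω => ?_)
    rw [norm_pow]
    refine pow_le_pow_left₀ (norm_nonneg _) ((norm_sub_le _ _).trans (add_le_add_left ?_ _)) 2
    rw [norm_mul, norm_inv, Real.norm_natCast]
    refine inv_mul_le_of_le_mul₀ (by positivity) (norm_nonneg _) ?_
    refine (norm_sum_le_of_le _ fun i _ => f.norm_coe_le_norm (L n i ω)).trans ?_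
    simp
  have h3 := mul_meas_ge_le_integral_of_nonneg (ae_of_all _ fun ω => sq_nonneg _) hint (ε ^ 2)
  have h4 : {ω | ε ≤ |(Fintype.card (ι n) : ℝ)⁻¹ * ∑ i, f (L n i ω) - ∫ x, f x ∂ν|} =
      {ω | ε ^ 2 ≤ ((Fintype.card (ι n) : ℝ)⁻¹ * ∑ i, f (L n i ω) - ∫ x, f x ∂ν) ^ 2} := by
    ext ω
    simp only [Set.mem_ofPred_eq]
    rw [sq_le_sq, abs_of_pos hε]
  rw [h4, ← ofReal_measureReal]
  refine ENNReal.ofReal_le_ofReal ((le_div_iff₀ (by positivity)).2 ?_)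
  rw [mul_comm]
  exact h3
end Convergence

/-! ### Choosing one element from each pair {a, a⁻¹} -/

section Representatives
variable {G : Type*} [CommGroup G] [Fintype G]

/-- A set of representatives of the classes `{a, a⁻¹}`. -/
noncomputable def inverseRepresentatives (G : Type*) [CommGroup G] [Fintype G] : Set G :=
  {a | Fintype.equivFin G a ≤ Fintype.equivFin G a⁻¹}

theorem inv_eq_of_mem_inverseRepresentatives {a : G} (h : a ∈ inverseRepresentatives G)
    (h' : a⁻¹ ∈ inverseRepresentatives G) : a⁻¹ = a := by
  have h1 : Fintype.equivFin G a ≤ Fintype.equivFin G a⁻¹ := h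
  have h2 : Fintype.equivFin G a⁻¹ ≤ Fintype.equivFin G a⁻¹⁻¹ := h'
  rw [inv_inv] at h2
  exact (Fintype.equivFin G).injective (le_antisymm h2 h1)

theorem mem_or_inv_mem_inverseRepresentatives (a : G) :
    a ∈ inverseRepresentatives G ∨ a⁻¹ ∈ inverseRepresentatives G := by
  rcases le_total (Fintype.equivFin G a) (Fintype.equivFin G a⁻¹) with h | h
  · exact Or.inl h
  · exact Or.inr (by simpa [inverseRepresentatives] using h)

open Classical in
-- With h the weighted summand extended by 0 off the representatives, h(a) + h(a⁻¹) = 2g(a) for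
-- every a, and inversion leaves the sum of h unchanged.
theorem sum_eq_sum_inverseRepresentatives {g : G → ℝ} (hg : ∀ a, g a⁻¹ = g a) :
    ∑ a, g a = ∑ a : inverseRepresentatives G,
      (if (a : G)⁻¹ = a then 1 else 2) * g a := by
  have h1 : ∑ a : inverseRepresentatives G, (if (a : G)⁻¹ = a then 1 else 2) * g a =
      ∑ a : G, if a ∈ inverseRepresentatives G then (if a⁻¹ = a then 1 else 2) * g a else 0 := by
    rw [← Finset.sum_filter]
    exact (Finset.sum_subtype _ (by simp) fun a : G => (if a⁻¹ = a then 1 else 2) * g a).symm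
  rw [h1]
  set h : G → ℝ := fun a =>
    if a ∈ inverseRepresentatives G then (if a⁻¹ = a then 1 else 2) * g a else 0 with hh
  have h2 : ∑ a, h a⁻¹ = ∑ a, h a := Equiv.sum_comp (Equiv.inv G) h
  have h3 : ∀ a, h a + h a⁻¹ = 2 * g a := by
    intro a
    by_cases ha : a⁻¹ = a
    · have : a ∈ inverseRepresentatives G := by
        rcases mem_or_inv_mem_inverseRepresentatives a with h | h
        · exact h
        · rwa [ha] at h
      rw [ha]
      simp only [hh, if_pos this, if_pos ha]
      ring
    · have ha' : ¬ a⁻¹⁻¹ = a⁻¹ := by rw [inv_inv]; exact fun h => ha h.symm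
      by_cases hr : a ∈ inverseRepresentatives G
      · have hr' : a⁻¹ ∉ inverseRepresentatives G := fun h =>
          ha (inv_eq_of_mem_inverseRepresentatives hr h)
        simp only [hh, if_pos hr, if_neg hr', if_neg ha]
        ring
      · have hr' := (mem_or_inv_mem_inverseRepresentatives a).resolve_left hr
        simp only [hh, if_neg hr, if_pos hr', if_neg ha', hg]
        ring
  have h4 : ∑ a, (h a + h a⁻¹) = ∑ a, 2 * g a := Finset.sum_congr rfl fun a _ => h3 a
  rw [Finset.sum_add_distrib, h2, ← Finset.mul_sum] at h4
  linarith

omit [CommGroup G] in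
theorem sum_subtype_le_sum (S : Set G) [Fintype S] {F : G → ℝ} (hF : ∀ a, 0 ≤ F a) :
    ∑ a : S, F a ≤ ∑ a, F a := by
  classical
  rw [← Finset.sum_subtype (Finset.univ.filter fun a => a ∈ S) (by simp) F]
  exact Finset.sum_le_univ_sum_of_nonneg hF
end Representatives

/-! ### Covariances of the eigenvalues -/

section Covariance
variable {G Ω : Type*} [CommGroup G] [Fintype G] [DecidableEq G] [MeasurableSpace Ω]
  {P : Measure Ω} {α β : ℝ} {Y : G → Ω → ℂ}

omit [Fintype G] in
-- An additive form of the four cases, suited to Fourier sums. When a² = 1 the first two indicators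
-- both fire and give 1 + α; the last term corrects this to β.
theorem covariance_eq_sum_ite
    (hcov : ∀ a b, ∫ ω, Y a ω * Y b ω ∂P =
      if a = b⁻¹ ∧ b⁻¹ ≠ a⁻¹ then 1
      else if a = b ∧ b ≠ a⁻¹ then (α : ℂ)
      else if a = b ∧ b = a⁻¹ then (β : ℂ)
      else 0) (a b : G) :
    ∫ ω, Y a ω * Y b ω ∂P = (if b = a⁻¹ then 1 else 0) + α * (if b = a then 1 else 0) +
      (β - α - 1) * (if b = a then if a ^ 2 = 1 then 1 else 0 else 0) := by
  rw [hcov]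
  have hsq : a ^ 2 = 1 ↔ a = a⁻¹ := by rw [sq, mul_eq_one_iff_eq_inv]
  by_cases h1 : b = a
  · subst h1
    by_cases h2 : b = b⁻¹
    · have h3 : b ^ 2 = 1 := hsq.2 h2
      rw [← h2]
      simp [h3]
      ring
    · have h3 : ¬ b ^ 2 = 1 := fun h => h2 (hsq.1 h)
      simp [h2, h3]
  · by_cases h2 : b = a⁻¹
    · subst h2
      simp [h1, Ne.symm h1]
    · have h3 : ¬ a = b⁻¹ := fun h => h2 (by rw [h, inv_inv])
      simp [h1, h2, h3, Ne.symm h1]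

omit [Fintype G] in
-- Almost surely |Y_a|² = Y_a Y_{a⁻¹}, whose mean is 1 or β; the sum 1 + β covers both cases.
theorem integral_norm_sq_le (hβ : 0 < β)
    (hherm : ∀ a, ∀ᵐ ω ∂P, Y a⁻¹ ω = conj (Y a ω))
    (hcov : ∀ a b, ∫ ω, Y a ω * Y b ω ∂P =
      if a = b⁻¹ ∧ b⁻¹ ≠ a⁻¹ then 1
      else if a = b ∧ b ≠ a⁻¹ then (α : ℂ)
      else if a = b ∧ b = a⁻¹ then (β : ℂ)
      else 0) (a : G) :
    ∫ ω, ‖Y a ω‖ ^ 2 ∂P ≤ 1 + β := by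
  have h1 : ((∫ ω, ‖Y a ω‖ ^ 2 ∂P : ℝ) : ℂ) = ∫ ω, Y a ω * Y a⁻¹ ω ∂P := by
    rw [← integral_complex_ofReal]
    refine integral_congr_ae ?_
    filter_upwards [hherm a] with ω hω
    rw [hω, Complex.mul_conj', Complex.ofReal_pow]
  rw [hcov] at h1
  by_cases h : a = a⁻¹
  · rw [← h] at h1
    simp [← h] at h1
    rw [h1]; linarith
  · simp [h] at h1
    norm_cast at h1
    rw [h1]; linarith

theorem integral_sum_mul_sum (hL2 : ∀ a, MemLp (Y a) 2 P)
    (hcov : ∀ a b, ∫ ω, Y a ω * Y b ω ∂P =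
      if a = b⁻¹ ∧ b⁻¹ ≠ a⁻¹ then 1
      else if a = b ∧ b ≠ a⁻¹ then (α : ℂ)
      else if a = b ∧ b = a⁻¹ then (β : ℂ)
      else 0) (c d : G → ℂ) :
    ∫ ω, (∑ a, c a * Y a ω) * (∑ a, d a * Y a ω) ∂P =
      ∑ a, c a * d a⁻¹ + α * ∑ a, c a * d a +
        (β - α - 1) * ∑ a with a ^ 2 = 1, c a * d a := by
  have hint : ∀ a b, Integrable (fun ω => c a * d b * (Y a ω * Y b ω)) P := fun a b =>
    ((hL2 a).integrable_mul (hL2 b)).const_mul _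
  have h1 : ∀ ω, (∑ a, c a * Y a ω) * (∑ a, d a * Y a ω) =
      ∑ a, ∑ b, c a * d b * (Y a ω * Y b ω) := by
    intro ω
    rw [Finset.sum_mul_sum]
    exact Finset.sum_congr rfl fun a _ => Finset.sum_congr rfl fun b _ => by ring
  simp_rw [h1]
  rw [integral_finsetSum _ fun a _ => integrable_finsetSum _ fun b _ => hint a b]
  have h2 : ∀ a, ∫ ω, ∑ b, c a * d b * (Y a ω * Y b ω) ∂P =
      c a * d a⁻¹ + α * (c a * d a) + (β - α - 1) * (if a ^ 2 = 1 then c a * d a else 0) := by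
    intro a
    rw [integral_finsetSum _ fun b _ => hint a b]
    simp_rw [integral_const_mul, covariance_eq_sum_ite hcov, mul_add, Finset.sum_add_distrib]
    congr 1
    · congr 1
      · simp
      · simp_rw [mul_ite, mul_one, mul_zero]
        simp; ring
    · simp_rw [mul_ite, mul_one, mul_zero]
      simp [mul_comm]
  simp_rw [h2, Finset.sum_add_distrib, ← Finset.mul_sum, ← Finset.sum_filter]

/-- The real part of the eigenvalue of the random circulant matrix at a character. -/
noncomputable def realEigenvalue (Y : G → Ω → ℂ) (χ : AddChar (Additive G) ℂ) (ω : Ω) : ℝ :=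
  (circulantEigenvalue (fun a => Y a ω) χ).re

omit [DecidableEq G] in
theorem memLp_realEigenvalue (hL2 : ∀ a, MemLp (Y a) 2 P) (χ : AddChar (Additive G) ℂ) :
    MemLp (realEigenvalue Y χ) 2 P := by
  refine MemLp.re (f := fun ω => circulantEigenvalue (fun a => Y a ω) χ) ?_
  exact (memLp_finsetSum _ fun a _ => (hL2 a).const_mul _).const_mul _

omit [DecidableEq G] in
theorem ae_ofReal_realEigenvalue (hherm : ∀ a, ∀ᵐ ω ∂P, Y a⁻¹ ω = conj (Y a ω)) :
    ∀ᵐ ω ∂P, ∀ χ, (realEigenvalue Y χ ω : ℂ) = circulantEigenvalue (fun a => Y a ω) χ := by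
  filter_upwards [ae_all_iff.2 hherm] with ω hω χ
  exact circulantEigenvalue_ofReal_re (y := fun a => Y a ω) hω χ

/-- The three parts of the additive covariance become character sums. Over all of G these collapse
by orthogonality; the sum over a² = 1 remains. -/
theorem integral_realEigenvalue_mul (hL2 : ∀ a, MemLp (Y a) 2 P)
    (hherm : ∀ a, ∀ᵐ ω ∂P, Y a⁻¹ ω = conj (Y a ω))
    (hcov : ∀ a b, ∫ ω, Y a ω * Y b ω ∂P =
      if a = b⁻¹ ∧ b⁻¹ ≠ a⁻¹ then 1
      else if a = b ∧ b ≠ a⁻¹ then (α : ℂ)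
      else if a = b ∧ b = a⁻¹ then (β : ℂ)
      else 0) (χ ψ : AddChar (Additive G) ℂ) :
    ((∫ ω, realEigenvalue Y χ ω * realEigenvalue Y ψ ω ∂P : ℝ) : ℂ) =
      (if χ = ψ then 1 else 0) + α * (if χ + ψ = 0 then 1 else 0) +
      (β - α - 1) * ((Fintype.card G : ℂ)⁻¹ * ∑ a with a ^ 2 = 1, (χ + ψ) (.ofMul a)) := by
  have hN : (Fintype.card G : ℂ) ≠ 0 := Nat.cast_ne_zero.2 Fintype.card_ne_zero
  have h1 : ((∫ ω, realEigenvalue Y χ ω * realEigenvalue Y ψ ω ∂P : ℝ) : ℂ) =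
      (Fintype.card G : ℂ)⁻¹ *
        ∫ ω, (∑ a, χ (.ofMul a) * Y a ω) * (∑ a, ψ (.ofMul a) * Y a ω) ∂P := by
    rw [← integral_complex_ofReal, ← integral_const_mul]
    refine integral_congr_ae ?_
    filter_upwards [ae_ofReal_realEigenvalue hherm] with ω hω
    rw [Complex.ofReal_mul, hω, hω, circulantEigenvalue, circulantEigenvalue, mul_mul_mul_comm,
      ← Complex.ofReal_mul]
    congr 1
    rw [div_mul_div_comm, Real.mul_self_sqrt (by positivity)]
    simp
  have h2 : ∑ a : G, χ (.ofMul a) * ψ (.ofMul a⁻¹) = if χ = ψ then (Fintype.card G : ℂ) else 0 := by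
    have h : (if χ = ψ then (Fintype.card G : ℂ) else 0) =
        if χ - ψ = 0 then (Fintype.card G : ℂ) else 0 := by simp only [sub_eq_zero]
    rw [h, ← AddChar.sum_multiplicative_eq_ite]
    refine Finset.sum_congr rfl fun a _ => ?_
    rw [AddChar.sub_apply', ofMul_inv, AddChar.map_neg_eq_inv, div_eq_mul_inv]
  have h3 : ∑ a : G, χ (.ofMul a) * ψ (.ofMul a) =
      if χ + ψ = 0 then (Fintype.card G : ℂ) else 0 := by
    rw [← AddChar.sum_multiplicative_eq_ite]
    rfl
  rw [h1, integral_sum_mul_sum hL2 hcov, h2, h3]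
  simp_rw [AddChar.add_apply]
  rw [mul_add, mul_add]
  congr 1
  · congr 1
    · split_ifs <;> simp [hN]
    · split_ifs
      · field_simp
      · simp
  · ring

theorem integral_realEigenvalue_sq (hL2 : ∀ a, MemLp (Y a) 2 P)
    (hherm : ∀ a, ∀ᵐ ω ∂P, Y a⁻¹ ω = conj (Y a ω))
    (hcov : ∀ a b, ∫ ω, Y a ω * Y b ω ∂P =
      if a = b⁻¹ ∧ b⁻¹ ≠ a⁻¹ then 1
      else if a = b ∧ b ≠ a⁻¹ then (α : ℂ)
      else if a = b ∧ b = a⁻¹ then (β : ℂ)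
      else 0) (χ : AddChar (Additive G) ℂ) :
    ∫ ω, realEigenvalue Y χ ω ^ 2 ∂P =
      1 + α * (if χ + χ = 0 then 1 else 0) + (β - α - 1) * involutionFraction G := by
  have h := integral_realEigenvalue_mul hL2 hherm hcov χ χ
  -- If a² = 1 then (χ + χ)(a) = χ(a²) = 1, so every summand is 1.
  have h2 : ∑ a : G with a ^ 2 = 1, (χ + χ) (.ofMul a) =
      (Finset.univ.filter fun a : G => a ^ 2 = 1).card := by
    rw [Finset.sum_congr rfl fun a ha => ?_, Finset.sum_const, nsmul_one]
    rw [AddChar.add_apply, ← AddChar.map_add_eq_mul, ← ofMul_mul, ← sq,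
      (Finset.mem_filter.1 ha).2, ofMul_one, AddChar.map_zero_eq_one]
  rw [h2, if_pos rfl] at h
  simp_rw [sq (realEigenvalue Y χ _)]
  rw [← Complex.ofReal_inj, h, involutionFraction]
  push_cast
  rw [apply_ite Complex.ofReal]
  simp only [Complex.ofReal_one, Complex.ofReal_zero]
  ring

/-- The indicators contribute at most 1 + α in total. The sums over a² = 1 are the Fourier transform
of an indicator function, so Parseval with Cauchy-Schwarz bounds their total modulus by |G|√|G|. -/
theorem sum_abs_integral_realEigenvalue_mul_le (hα : 0 ≤ α) (hL2 : ∀ a, MemLp (Y a) 2 P)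
    (hherm : ∀ a, ∀ᵐ ω ∂P, Y a⁻¹ ω = conj (Y a ω))
    (hcov : ∀ a b, ∫ ω, Y a ω * Y b ω ∂P =
      if a = b⁻¹ ∧ b⁻¹ ≠ a⁻¹ then 1
      else if a = b ∧ b ≠ a⁻¹ then (α : ℂ)
      else if a = b ∧ b = a⁻¹ then (β : ℂ)
      else 0) (χ : AddChar (Additive G) ℂ) :
    ∑ ψ, |∫ ω, realEigenvalue Y χ ω * realEigenvalue Y ψ ω ∂P| ≤
      1 + α + |β - α - 1| * √(Fintype.card G : ℝ) := by
  have h1 : ∀ ψ, |∫ ω, realEigenvalue Y χ ω * realEigenvalue Y ψ ω ∂P| ≤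
      (if χ = ψ then 1 else 0) + α * (if ψ = -χ then 1 else 0) +
      |β - α - 1| * ((Fintype.card G : ℝ)⁻¹ * ‖∑ a with a ^ 2 = 1, (χ + ψ) (.ofMul a)‖) := by
    intro ψ
    rw [← Real.norm_eq_abs, ← Complex.norm_real, integral_realEigenvalue_mul hL2 hherm hcov]
    refine (norm_add₃_le).trans (add_le_add (add_le_add ?_ ?_) ?_)
    · split_ifs <;> simp
    · have : χ + ψ = 0 ↔ ψ = -χ := by rw [add_comm, add_eq_zero_iff_eq_neg]
      simp_rw [this]
      split_ifs <;> simp [abs_of_nonneg hα]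
    · rw [norm_mul, norm_mul, norm_inv, Complex.norm_natCast]
      have : (β - α - 1 : ℂ) = ((β - α - 1 : ℝ) : ℂ) := by push_cast; rfl
      rw [this, Complex.norm_real, Real.norm_eq_abs]
  refine (Finset.sum_le_sum fun ψ _ => h1 ψ).trans ?_
  rw [Finset.sum_add_distrib, Finset.sum_add_distrib, ← Finset.mul_sum, ← Finset.mul_sum,
    ← Finset.mul_sum]
  have h2 := sum_norm_sum_char_le (Finset.univ.filter fun a : G => a ^ 2 = 1)
  -- As ψ runs over the dual group, so does χ + ψ.
  rw [← Equiv.sum_comp (Equiv.addLeft χ)] at h2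
  simp only [Equiv.coe_addLeft] at h2
  have hN : (0 : ℝ) < Fintype.card G := Nat.cast_pos.2 Fintype.card_pos
  have h3 := (inv_mul_le_iff₀ hN).2 h2
  have h4 := mul_le_mul_of_nonneg_left h3 (abs_nonneg (β - α - 1))
  simp only [Finset.sum_ite_eq, Finset.sum_ite_eq', Finset.mem_univ, if_true, mul_one]
  linarith
end Covariance

/-! ### Gaussian approximation of linear combinations -/

section Linear
variable {G Ω : Type*} [CommGroup G] [Fintype G] [MeasurableSpace Ω]
  {P : Measure Ω} [IsProbabilityMeasure P] {Y : G → Ω → ℂ}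

/-- The quantity that the Lindeberg condition requires to tend to zero. -/
noncomputable def lindebergSum (P : Measure Ω) (Y : G → Ω → ℂ) (ε : ℝ) : ℝ :=
  (1 / (Fintype.card G : ℝ)) *
    ∑ a : G, ∫ ω, Set.indicator {ω | ε * √(Fintype.card G : ℝ) ≤ ‖Y a ω‖}
      (fun ω => ‖Y a ω‖ ^ 2) ω ∂P

omit [IsProbabilityMeasure P] in
theorem integrable_indicator_norm_sq {X : Ω → ℂ} (hX : MemLp X 2 P) (r : ℝ) :
    Integrable (fun ω => Set.indicator {ω | r ≤ ‖X ω‖} (fun ω => ‖X ω‖ ^ 2) ω) P := by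
  have := (integrable_indicator_sq hX.norm r)
  refine this.congr (ae_of_all _ fun ω => ?_)
  simp only [Set.indicator_apply, Set.mem_ofPred_eq, abs_norm]

/-- The central limit theorem for real linear combinations of the family. -/
theorem norm_integral_exp_linear_sub_le {β : ℝ} (hL2 : ∀ a, MemLp (Y a) 2 P)
    (hmean : ∀ a, ∫ ω, Y a ω ∂P = 0)
    (hherm : ∀ a, ∀ᵐ ω ∂P, Y a⁻¹ ω = conj (Y a ω)) (hindep : IndepUpToInverse P Y)
    (hsq : ∀ a, ∫ ω, ‖Y a ω‖ ^ 2 ∂P ≤ 1 + β)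
    {c : G → ℂ} (hc : ∀ a, c a⁻¹ = conj (c a)) {M : ℝ} (hM : 0 ≤ M) (hcM : ∀ a, ‖c a‖ ≤ M)
    {δ : ℝ} (hδ : 0 < δ) (hδ1 : δ ≤ 1) {S : Ω → ℝ}
    (hS : ∀ ω, S ω = (((1 / √(Fintype.card G : ℝ) : ℝ) : ℂ) * ∑ a, c a * Y a ω).re) :
    ‖∫ ω, Complex.exp (S ω * Complex.I) ∂P - Real.exp (-((∫ ω, S ω ^ 2 ∂P) / 2))‖ ≤
      3 * δ * ((2 * M + 1) ^ 2 * (1 + β)) +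
      4 * ((2 * M + 1) ^ 2 * lindebergSum P Y (δ / (2 * M + 1))) +
      ((2 * M + 1) ^ 2 * (1 + β)) ^ 2 / Fintype.card G := by
  classical
  -- The 2 is the largest weight of a representative and M bounds the coefficients; the added 1
  -- keeps C positive when M = 0.
  set C := 2 * M + 1 with hC
  have hCpos : 0 < C := by positivity
  set N : ℝ := (Fintype.card G : ℝ) with hN
  have hNpos : 0 < N := Nat.cast_pos.2 Fintype.card_pos
  have hsN : 0 < √N := Real.sqrt_pos.2 hNpos
  let w : G → ℝ := fun a => if a⁻¹ = a then 1 else 2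
  have hw : ∀ a, |w a| ≤ 2 := by
    intro a; simp only [w]; split_ifs <;> norm_num
  let g : G → ℂ → ℝ := fun a z => 1 / √N * (w a * (c a * z).re)
  have hgm : ∀ a, Measurable (g a) := fun a => by fun_prop
  let Z : inverseRepresentatives G → Ω → ℝ := fun a ω => g a (Y a ω)
  have hgle : ∀ a z, |g a z| ≤ C / √N * ‖z‖ := by
    intro a z
    simp only [g]
    rw [abs_mul, abs_mul, abs_of_pos (by positivity), div_mul_eq_mul_div, one_mul,
      div_mul_eq_mul_div]
    refine div_le_div_of_nonneg_right ?_ hsN.le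
    have h1 : |(c a * z).re| ≤ M * ‖z‖ := (Complex.abs_re_le_norm _).trans (by
      rw [norm_mul]; exact mul_le_mul_of_nonneg_right (hcM a) (norm_nonneg _))
    have h2 := mul_le_mul (hw a) h1 (abs_nonneg _) (by norm_num)
    have := norm_nonneg z
    rw [hC]
    linarith
  have hgsq : ∀ a z, g a z ^ 2 ≤ C ^ 2 / N * ‖z‖ ^ 2 := by
    intro a z
    rw [← sq_abs]
    refine (pow_le_pow_left₀ (abs_nonneg _) (hgle a z) 2).trans (le_of_eq ?_)
    rw [mul_pow, div_pow, Real.sq_sqrt hNpos.le]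
  have hZmem : ∀ a, MemLp (Z a) 2 P := fun a =>
    MemLp.re (f := fun ω => c a * Y a ω) ((hL2 a).const_mul _) |>.const_mul _ |>.const_mul _
  have hZmean : ∀ a, ∫ ω, Z a ω ∂P = 0 := by
    intro a
    simp only [Z, g]
    rw [integral_const_mul, integral_const_mul]
    have h1 : ∫ ω, (c a * Y a ω).re ∂P = (∫ ω, c a * Y a ω ∂P).re :=
      integral_re (𝕜 := ℂ) (((hL2 a).const_mul (c a)).integrable (by norm_num))
    rw [h1, integral_const_mul, hmean]
    simp
  -- Representatives contain no two distinct mutually inverse indices, which is exactly what the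
  -- independence hypothesis requires.
  have hZind : iIndepFun Z P :=
    (hindep (inverseRepresentatives G) fun a h h' =>
      inv_eq_of_mem_inverseRepresentatives h h').comp (fun a => g a) fun a => hgm a
  have hSZ : ∀ᵐ ω ∂P, S ω = ∑ a, Z a ω := by
    filter_upwards [ae_all_iff.2 hherm] with ω hω
    have h1 : ∀ a, (c a⁻¹ * Y a⁻¹ ω).re = (c a * Y a ω).re := by
      intro a
      rw [hc, hω, ← map_mul, Complex.conj_re]
    rw [hS, Complex.re_ofReal_mul, Complex.re_sum, sum_eq_sum_inverseRepresentatives h1,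
      Finset.mul_sum]
  have e1 : ∫ ω, Complex.exp (S ω * Complex.I) ∂P =
      ∫ ω, Complex.exp ((∑ a, Z a ω : ℝ) * Complex.I) ∂P :=
    integral_congr_ae (by filter_upwards [hSZ] with ω hω; rw [hω])
  have e2 : ∫ ω, S ω ^ 2 ∂P = ∫ ω, (∑ a, Z a ω) ^ 2 ∂P :=
    integral_congr_ae (by filter_upwards [hSZ] with ω hω; rw [hω])
  rw [e1, e2]
  refine (norm_integral_exp_sum_sub_le hZmem hZmean hZind hδ hδ1).trans ?_
  have hYint : ∀ a, Integrable (fun ω => ‖Y a ω‖ ^ 2) P := fun a => (hL2 a).norm.integrable_sq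
  have hb1 : ∀ a, ∫ ω, Z a ω ^ 2 ∂P ≤ C ^ 2 * (1 + β) / N := by
    intro a
    refine (integral_mono (hZmem a).integrable_sq ((hYint a).const_mul (C ^ 2 / N))
      fun ω => hgsq a (Y a ω)).trans ?_
    rw [integral_const_mul, div_mul_eq_mul_div]
    exact div_le_div_of_nonneg_right (mul_le_mul_of_nonneg_left (hsq a) (by positivity)) hNpos.le
  -- Since |Z_a| ≤ C|Y_a|/√N, the event |Z_a| ≥ δ forces |Y_a| ≥ (δ/C)√N, whence the Lindeberg
  -- threshold δ/C.
  have hb2 : ∀ a : inverseRepresentatives G,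
      ∫ ω, Set.indicator {x : ℝ | δ ≤ |x|} (fun x => x ^ 2) (Z a ω) ∂P ≤
      C ^ 2 / N * ∫ ω, Set.indicator {ω | δ / C * √N ≤ ‖Y a ω‖} (fun ω => ‖Y a ω‖ ^ 2) ω ∂P := by
    intro a
    rw [← integral_const_mul]
    refine integral_mono (integrable_indicator_sq (hZmem a) δ)
      ((integrable_indicator_norm_sq (hL2 a) _).const_mul _) fun ω => ?_
    simp only
    by_cases h : δ ≤ |Z a ω|
    · have h1 : δ / C * √N ≤ ‖Y a ω‖ := by
        have h2 := h.trans (hgle a (Y a ω))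
        rw [div_mul_eq_mul_div, div_le_iff₀ hCpos]
        rw [div_mul_eq_mul_div, le_div_iff₀ hsN] at h2
        linarith
      rw [Set.indicator_of_mem (by exact h), Set.indicator_of_mem (by exact h1)]
      exact hgsq a (Y a ω)
    · rw [Set.indicator_of_notMem (by exact h)]
      exact mul_nonneg (by positivity) (Set.indicator_nonneg (fun _ _ => sq_nonneg _) _)
  have hβ : 0 ≤ 1 + β := (integral_nonneg fun ω => sq_nonneg _).trans (hsq 1)
  have hb3 : ∀ a : G, 0 ≤ ∫ ω, Set.indicator {ω | δ / C * √N ≤ ‖Y a ω‖}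
      (fun ω => ‖Y a ω‖ ^ 2) ω ∂P := fun a =>
    integral_nonneg fun ω => Set.indicator_nonneg (fun _ _ => sq_nonneg _) _
  let F : G → ℝ := fun a => 3 * δ * (C ^ 2 * (1 + β) / N) +
      4 * (C ^ 2 / N * ∫ ω, Set.indicator {ω | δ / C * √N ≤ ‖Y a ω‖}
        (fun ω => ‖Y a ω‖ ^ 2) ω ∂P) + (C ^ 2 * (1 + β) / N) ^ 2
  have hF : ∀ a, 0 ≤ F a := fun a => by
    have := hb3 a
    simp only [F]
    positivity
  calc _ ≤ ∑ a : inverseRepresentatives G, F a := by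
        refine Finset.sum_le_sum fun a _ => add_le_add (add_le_add ?_ ?_) ?_
        · exact mul_le_mul_of_nonneg_left (hb1 a) (by positivity)
        · exact mul_le_mul_of_nonneg_left (hb2 a) (by norm_num)
        · exact pow_le_pow_left₀ (integral_nonneg fun ω => sq_nonneg _) (hb1 a) 2
    _ ≤ ∑ a, F a := sum_subtype_le_sum _ hF
    _ = _ := by
        simp only [F, Finset.sum_add_distrib, ← Finset.mul_sum, Finset.sum_const, Finset.card_univ,
          nsmul_eq_mul, lindebergSum]
        rw [← hN]
        field_simp

end Linear

/-! ### Joint characteristic functions of two eigenvalues -/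

section Pair
variable {G Ω : Type*} [CommGroup G] [Fintype G] [DecidableEq G] [MeasurableSpace Ω]
  {P : Measure Ω} [IsProbabilityMeasure P] {Y : G → Ω → ℂ} {α β : ℝ}

/-- The joint characteristic function of two eigenvalues is nearly that of independent
Gaussians, up to their covariance. -/
theorem norm_integral_exp_realEigenvalue_sub_le (hβ : 0 < β) (hL2 : ∀ a, MemLp (Y a) 2 P)
    (hmean : ∀ a, ∫ ω, Y a ω ∂P = 0)
    (hherm : ∀ a, ∀ᵐ ω ∂P, Y a⁻¹ ω = conj (Y a ω)) (hindep : IndepUpToInverse P Y)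
    (hcov : ∀ a b, ∫ ω, Y a ω * Y b ω ∂P =
      if a = b⁻¹ ∧ b⁻¹ ≠ a⁻¹ then 1
      else if a = b ∧ b ≠ a⁻¹ then (α : ℂ)
      else if a = b ∧ b = a⁻¹ then (β : ℂ)
      else 0) {δ : ℝ} (hδ : 0 < δ) (hδ1 : δ ≤ 1) (s t : ℝ) (χ ψ : AddChar (Additive G) ℂ) :
    ‖∫ ω, Complex.exp ((s * realEigenvalue Y χ ω + t * realEigenvalue Y ψ ω : ℝ) * Complex.I) ∂P -
      (Real.exp (-(s ^ 2 * (∫ ω, realEigenvalue Y χ ω ^ 2 ∂P) / 2)) *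
        Real.exp (-(t ^ 2 * (∫ ω, realEigenvalue Y ψ ω ^ 2 ∂P) / 2)) : ℝ)‖ ≤
      3 * δ * ((2 * (|s| + |t|) + 1) ^ 2 * (1 + β)) +
      4 * ((2 * (|s| + |t|) + 1) ^ 2 * lindebergSum P Y (δ / (2 * (|s| + |t|) + 1))) +
      ((2 * (|s| + |t|) + 1) ^ 2 * (1 + β)) ^ 2 / Fintype.card G +
      |s * t| * |∫ ω, realEigenvalue Y χ ω * realEigenvalue Y ψ ω ∂P| := by
  have h1 := norm_integral_exp_linear_sub_le hL2 hmean hherm hindep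
    (integral_norm_sq_le hβ hherm hcov) (c := fun a => s * χ (.ofMul a) + t * ψ (.ofMul a))
    (fun a => by
      rw [map_add, map_mul, map_mul, conj_char_ofMul, conj_char_ofMul, Complex.conj_ofReal,
        Complex.conj_ofReal])
    (M := |s| + |t|) (by positivity)
    (fun a => by
      refine (norm_add_le _ _).trans (le_of_eq ?_)
      rw [norm_mul, norm_mul, AddChar.norm_apply, AddChar.norm_apply]
      simp)
    hδ hδ1 (S := fun ω => s * realEigenvalue Y χ ω + t * realEigenvalue Y ψ ω)
    (fun ω => by
      simp only [realEigenvalue, circulantEigenvalue]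
      rw [← Complex.re_ofReal_mul, ← Complex.re_ofReal_mul, ← Complex.add_re]
      congr 1
      simp_rw [add_mul, Finset.sum_add_distrib, mul_assoc, ← Finset.mul_sum]
      ring)
  have hm := fun χ => memLp_realEigenvalue hL2 χ
  have hi1 := fun χ => (hm χ).integrable_sq
  have hi2 : Integrable (fun ω => realEigenvalue Y χ ω * realEigenvalue Y ψ ω) P :=
    (hm χ).integrable_mul (hm ψ)
  set u := ∫ ω, realEigenvalue Y χ ω ^ 2 ∂P
  set v := ∫ ω, realEigenvalue Y ψ ω ^ 2 ∂P
  set k := ∫ ω, realEigenvalue Y χ ω * realEigenvalue Y ψ ω ∂P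
  have hu : 0 ≤ u := integral_nonneg fun ω => sq_nonneg _
  have hv : 0 ≤ v := integral_nonneg fun ω => sq_nonneg _
  have hq : ∫ ω, (s * realEigenvalue Y χ ω + t * realEigenvalue Y ψ ω) ^ 2 ∂P =
      s ^ 2 * u + t ^ 2 * v + 2 * (s * t) * k := by
    have h2 : ∀ ω, (s * realEigenvalue Y χ ω + t * realEigenvalue Y ψ ω) ^ 2 =
        s ^ 2 * realEigenvalue Y χ ω ^ 2 + t ^ 2 * realEigenvalue Y ψ ω ^ 2 +
        2 * (s * t) * (realEigenvalue Y χ ω * realEigenvalue Y ψ ω) := fun ω => by ring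
    simp_rw [h2]
    have h3 : Integrable (fun ω => s ^ 2 * realEigenvalue Y χ ω ^ 2 +
        t ^ 2 * realEigenvalue Y ψ ω ^ 2) P := ((hi1 χ).const_mul _).add ((hi1 ψ).const_mul _)
    rw [integral_add h3 (hi2.const_mul _),
      integral_add ((hi1 χ).const_mul _) ((hi1 ψ).const_mul _), integral_const_mul,
      integral_const_mul, integral_const_mul]
  have hq0 : 0 ≤ s ^ 2 * u + t ^ 2 * v + 2 * (s * t) * k :=
    hq ▸ integral_nonneg fun ω => sq_nonneg _
  rw [hq] at h1
  -- Dropping the cross term stk from the Gaussian exponent costs at most its absolute value, as x ↦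
  -- exp(-x) is 1-Lipschitz on [0, ∞).
  have h3 : ‖((Real.exp (-((s ^ 2 * u + t ^ 2 * v + 2 * (s * t) * k) / 2)) : ℝ) : ℂ) -
      (Real.exp (-(s ^ 2 * u / 2)) * Real.exp (-(t ^ 2 * v / 2)) : ℝ)‖ ≤ |s * t| * |k| := by
    rw [← Complex.ofReal_sub, Complex.norm_real, Real.norm_eq_abs, ← Real.exp_add]
    have h4 := abs_exp_neg_sub_exp_neg_le
      (x := (s ^ 2 * u + t ^ 2 * v + 2 * (s * t) * k) / 2) (y := s ^ 2 * u / 2 + t ^ 2 * v / 2)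
      (by positivity) (by positivity)
    rw [neg_add] at h4
    refine h4.trans (le_of_eq ?_)
    rw [← abs_mul]
    congr 1
    ring
  exact (norm_sub_le_norm_sub_add_norm_sub _ _ _).trans (add_le_add h1 h3)

/-- The Lindeberg error is the same for all pairs and survives averaging unchanged, while the
covariance error gains a factor 1/|G| over its row sum of order √|G|. -/
theorem norm_average_integral_exp_sub_le (hα : 0 ≤ α) (hβ : 0 < β) (hL2 : ∀ a, MemLp (Y a) 2 P)
    (hmean : ∀ a, ∫ ω, Y a ω ∂P = 0)
    (hherm : ∀ a, ∀ᵐ ω ∂P, Y a⁻¹ ω = conj (Y a ω)) (hindep : IndepUpToInverse P Y)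
    (hcov : ∀ a b, ∫ ω, Y a ω * Y b ω ∂P =
      if a = b⁻¹ ∧ b⁻¹ ≠ a⁻¹ then 1
      else if a = b ∧ b ≠ a⁻¹ then (α : ℂ)
      else if a = b ∧ b = a⁻¹ then (β : ℂ)
      else 0) {δ : ℝ} (hδ : 0 < δ) (hδ1 : δ ≤ 1) (s t : ℝ) {κ : ℝ → ℝ}
    (hκ : ∀ s, κ s = (1 - involutionFraction G) *
        Real.exp (-(s ^ 2 * (1 + (β - α - 1) * involutionFraction G) / 2)) +
      involutionFraction G *
        Real.exp (-(s ^ 2 * (1 + α + (β - α - 1) * involutionFraction G) / 2))) :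
    ‖((Fintype.card (AddChar (Additive G) ℂ) : ℝ)⁻¹ *
        (Fintype.card (AddChar (Additive G) ℂ) : ℝ)⁻¹) •
      ∑ χ, ∑ ψ, ∫ ω, Complex.exp
        ((s * realEigenvalue Y χ ω + t * realEigenvalue Y ψ ω : ℝ) * Complex.I) ∂P -
      (κ s * κ t : ℝ)‖ ≤
      3 * δ * ((2 * (|s| + |t|) + 1) ^ 2 * (1 + β)) +
      4 * ((2 * (|s| + |t|) + 1) ^ 2 * lindebergSum P Y (δ / (2 * (|s| + |t|) + 1))) +
      ((2 * (|s| + |t|) + 1) ^ 2 * (1 + β)) ^ 2 / Fintype.card G +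
      |s * t| * ((1 + α) / Fintype.card G + |β - α - 1| / √(Fintype.card G : ℝ)) := by
  set N : ℝ := (Fintype.card G : ℝ) with hN
  have hNpos : 0 < N := Nat.cast_pos.2 Fintype.card_pos
  rw [card_addChar_additive, ← hN]
  set E := 3 * δ * ((2 * (|s| + |t|) + 1) ^ 2 * (1 + β)) +
      4 * ((2 * (|s| + |t|) + 1) ^ 2 * lindebergSum P Y (δ / (2 * (|s| + |t|) + 1))) +
      ((2 * (|s| + |t|) + 1) ^ 2 * (1 + β)) ^ 2 / N with hE
  let e : ℝ → AddChar (Additive G) ℂ → ℝ := fun s χ =>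
    Real.exp (-(s ^ 2 * (∫ ω, realEigenvalue Y χ ω ^ 2 ∂P) / 2))
  -- An exact identity: the variance takes two values, according to whether χ² = 1, and the number
  -- of χ of each kind is known.
  have hκ' : ∀ s, κ s = N⁻¹ * ∑ χ, e s χ := by
    intro s
    have h1 : ∀ χ : AddChar (Additive G) ℂ, e s χ = if χ + χ = 0 then
        Real.exp (-(s ^ 2 * (1 + α + (β - α - 1) * involutionFraction G) / 2)) else
        Real.exp (-(s ^ 2 * (1 + (β - α - 1) * involutionFraction G) / 2)) := by
      intro χ
      simp only [e]
      rw [integral_realEigenvalue_sq hL2 hherm hcov]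
      split_ifs <;> simp
    simp_rw [h1]
    rw [Finset.sum_ite, Finset.sum_const, Finset.sum_const, nsmul_eq_mul, nsmul_eq_mul,
      card_char_sq_trivial]
    have h2 := Finset.card_filter_add_card_filter_not (s := Finset.univ)
      (fun χ : AddChar (Additive G) ℂ => χ + χ = 0)
    rw [Finset.card_univ, card_addChar_additive] at h2
    have h3 : ((Finset.univ.filter fun χ : AddChar (Additive G) ℂ => ¬ χ + χ = 0).card : ℝ) =
        N - N * involutionFraction G := by
      rw [← card_char_sq_trivial, hN, ← h2]
      push_cast
      ring
    rw [h3, hκ, ← hN]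
    field_simp
    ring
  have h1 : ((κ s * κ t : ℝ) : ℂ) = (N⁻¹ * N⁻¹) • ∑ χ, ∑ ψ, ((e s χ * e t ψ : ℝ) : ℂ) := by
    rw [hκ', hκ', mul_mul_mul_comm, Finset.sum_mul_sum, Complex.real_smul, Complex.ofReal_mul]
    simp only [Complex.ofReal_sum]
  rw [h1, ← smul_sub, ← Finset.sum_sub_distrib, norm_smul, Real.norm_of_nonneg (by positivity)]
  simp_rw [← Finset.sum_sub_distrib]
  have h2 : ∀ χ : AddChar (Additive G) ℂ, ‖∑ ψ : AddChar (Additive G) ℂ, (∫ ω, Complex.exp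
        ((s * realEigenvalue Y χ ω + t * realEigenvalue Y ψ ω : ℝ) * Complex.I) ∂P -
      ((e s χ * e t ψ : ℝ) : ℂ))‖ ≤ N * E + |s * t| * (1 + α + |β - α - 1| * √N) := by
    intro χ
    refine (norm_sum_le_of_le _ fun ψ _ => norm_integral_exp_realEigenvalue_sub_le hβ hL2 hmean
      hherm hindep hcov hδ hδ1 s t χ ψ).trans ?_
    rw [← hN, ← hE, Finset.sum_add_distrib, ← Finset.mul_sum, Finset.sum_const, Finset.card_univ,
      card_addChar_additive, nsmul_eq_mul]
    exact add_le_add_right (mul_le_mul_of_nonneg_left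
      (sum_abs_integral_realEigenvalue_mul_le hα hL2 hherm hcov χ) (abs_nonneg _)) _
  refine (mul_le_mul_of_nonneg_left (norm_sum_le_of_le _ fun χ _ => h2 χ)
    (by positivity)).trans (le_of_eq ?_)
  rw [Finset.sum_const, Finset.card_univ, card_addChar_additive, nsmul_eq_mul, ← hN]
  have hs : |β - α - 1| / √N = |β - α - 1| * √N / N := by
    rw [div_eq_div_iff (Real.sqrt_pos.2 hNpos).ne' hNpos.ne', mul_assoc,
      Real.mul_self_sqrt hNpos.le]
  rw [hs]
  field_simp
end Pair

/-! ### Passage to the limit along the sequence of groups -/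

section Limit
variable {G : ℕ → Type*} [∀ n, CommGroup (G n)] [∀ n, Fintype (G n)] [∀ n, DecidableEq (G n)]
  {Ω : ℕ → Type*} [∀ n, MeasurableSpace (Ω n)] {P : ∀ n, Measure (Ω n)}
  [∀ n, IsProbabilityMeasure (P n)] {α β : ℝ} {Y : ∀ n, G n → Ω n → ℂ} {p : ℝ}

theorem tendsto_average_integral_exp (hG : Tendsto (fun n => Fintype.card (G n)) atTop atTop)
    (hα : 0 ≤ α) (hβ : 0 < β) (hL2 : ∀ n a, MemLp (Y n a) 2 (P n))
    (hmean : ∀ n a, ∫ ω, Y n a ω ∂(P n) = 0)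
    (hherm : ∀ n a, ∀ᵐ ω ∂(P n), Y n a⁻¹ ω = conj (Y n a ω))
    (hindep : ∀ n, IndepUpToInverse (P n) (Y n))
    (hcov : ∀ n a b, ∫ ω, Y n a ω * Y n b ω ∂(P n) =
      if a = b⁻¹ ∧ b⁻¹ ≠ a⁻¹ then 1
      else if a = b ∧ b ≠ a⁻¹ then (α : ℂ)
      else if a = b ∧ b = a⁻¹ then (β : ℂ)
      else 0)
    (hLind : LindebergCondition P Y)
    (hp : Tendsto (fun n => involutionFraction (G n)) atTop (𝓝 p)) {κ : ℝ → ℝ}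
    (hκ : ∀ s, κ s = (1 - p) * Real.exp (-(s ^ 2 * (1 + (β - α - 1) * p) / 2)) +
      p * Real.exp (-(s ^ 2 * (1 + α + (β - α - 1) * p) / 2))) (s t : ℝ) :
    Tendsto (fun n => ((Fintype.card (AddChar (Additive (G n)) ℂ) : ℝ)⁻¹ *
        (Fintype.card (AddChar (Additive (G n)) ℂ) : ℝ)⁻¹) •
      ∑ χ, ∑ ψ, ∫ ω, Complex.exp ((s * realEigenvalue (Y n) χ ω +
        t * realEigenvalue (Y n) ψ ω : ℝ) * Complex.I) ∂(P n)) atTop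
      (𝓝 ((κ s : ℂ) * κ t)) := by
  let κ' : ℕ → ℝ → ℝ := fun n s => (1 - involutionFraction (G n)) *
        Real.exp (-(s ^ 2 * (1 + (β - α - 1) * involutionFraction (G n)) / 2)) +
      involutionFraction (G n) *
        Real.exp (-(s ^ 2 * (1 + α + (β - α - 1) * involutionFraction (G n)) / 2))
  have hκlim : ∀ s, Tendsto (fun n => κ' n s) atTop (𝓝 (κ s)) := by
    intro s
    rw [hκ]
    have hc : Continuous fun q : ℝ => (1 - q) * Real.exp (-(s ^ 2 * (1 + (β - α - 1) * q) / 2)) +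
      q * Real.exp (-(s ^ 2 * (1 + α + (β - α - 1) * q) / 2)) := by fun_prop
    exact (hc.tendsto p).comp hp
  have hprod : Tendsto (fun n => ((κ' n s * κ' n t : ℝ) : ℂ)) atTop (𝓝 ((κ s : ℂ) * κ t)) := by
    rw [← Complex.ofReal_mul]
    exact (Complex.continuous_ofReal.tendsto _).comp ((hκlim s).mul (hκlim t))
  refine tendsto_of_tendsto_of_dist hprod ?_
  have hNlim : Tendsto (fun n => (Fintype.card (G n) : ℝ)) atTop atTop :=
    tendsto_natCast_atTop_atTop.comp hG
  have hsNlim := Real.tendsto_sqrt_atTop.comp hNlim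
  set C := 2 * (|s| + |t|) + 1 with hC
  have hCpos : 0 < C := by positivity
  rw [Metric.tendsto_atTop]
  intro ε hε
  -- The cutoff δ is fixed before n: the term linear in δ does not depend on n, and for fixed δ all
  -- the others tend to 0.
  obtain ⟨δ, hδ, hδ1, hδε⟩ : ∃ δ : ℝ, 0 < δ ∧ δ ≤ 1 ∧ 3 * δ * (C ^ 2 * (1 + β)) ≤ ε / 2 := by
    have hA : 0 < 3 * (C ^ 2 * (1 + β)) := by positivity
    refine ⟨min 1 (ε / 2 / (3 * (C ^ 2 * (1 + β)))), by positivity, min_le_left _ _, ?_⟩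
    have := (le_div_iff₀ hA).1 (min_le_right 1 (ε / 2 / (3 * (C ^ 2 * (1 + β)))))
    linarith
  have hrest : Tendsto (fun n => 4 * (C ^ 2 * lindebergSum (P n) (Y n) (δ / C)) +
      (C ^ 2 * (1 + β)) ^ 2 / Fintype.card (G n) +
      |s * t| * ((1 + α) / Fintype.card (G n) + |β - α - 1| / √(Fintype.card (G n) : ℝ)))
      atTop (𝓝 0) := by
    have h1 : Tendsto (fun n => lindebergSum (P n) (Y n) (δ / C)) atTop (𝓝 0) :=
      hLind (δ / C) (by positivity)
    have h2 := ((h1.const_mul (C ^ 2)).const_mul 4).add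
      (hNlim.const_div_atTop ((C ^ 2 * (1 + β)) ^ 2)) |>.add
      (((hNlim.const_div_atTop (1 + α)).add (hsNlim.const_div_atTop |β - α - 1|)).const_mul |s * t|)
    simpa using h2
  obtain ⟨n₀, hn₀⟩ := Metric.tendsto_atTop.1 hrest (ε / 2) (by positivity)
  refine ⟨n₀, fun n hn => ?_⟩
  have h1 := norm_average_integral_exp_sub_le hα hβ (hL2 n) (hmean n) (hherm n) (hindep n)
    (hcov n) hδ hδ1 s t (κ := κ' n) fun _ => rfl
  have h2 := hn₀ n hn
  rw [Real.dist_eq, sub_zero] at h2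
  have h3 := (le_abs_self _).trans_lt h2
  rw [Real.dist_eq, sub_zero, abs_of_nonneg dist_nonneg, dist_comm, dist_eq_norm]
  rw [← hC] at h1
  linarith

/-- The spectrum is real only almost surely, so the integrals against the spectral measure are
replaced, up to null sets, by averages of the restriction of f to the real axis. -/
theorem weaklyConverges_of_charFun (hG : Tendsto (fun n => Fintype.card (G n)) atTop atTop)
    (hα : 0 ≤ α) (hβ : 0 < β) (hL2 : ∀ n a, MemLp (Y n a) 2 (P n))
    (hmean : ∀ n a, ∫ ω, Y n a ω ∂(P n) = 0)
    (hherm : ∀ n a, ∀ᵐ ω ∂(P n), Y n a⁻¹ ω = conj (Y n a ω))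
    (hindep : ∀ n, IndepUpToInverse (P n) (Y n))
    (hcov : ∀ n a b, ∫ ω, Y n a ω * Y n b ω ∂(P n) =
      if a = b⁻¹ ∧ b⁻¹ ≠ a⁻¹ then 1
      else if a = b ∧ b ≠ a⁻¹ then (α : ℂ)
      else if a = b ∧ b = a⁻¹ then (β : ℂ)
      else 0)
    (hLind : LindebergCondition P Y)
    (hp : Tendsto (fun n => involutionFraction (G n)) atTop (𝓝 p))
    (ν : Measure ℝ) [IsProbabilityMeasure ν]
    (hν : ∀ s, charFun ν s = ((1 - p) * Real.exp (-(s ^ 2 * (1 + (β - α - 1) * p) / 2)) +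
      p * Real.exp (-(s ^ 2 * (1 + α + (β - α - 1) * p) / 2)) : ℝ)) :
    WeaklyConvergesInMean P
        (fun n ω => empiricalSpectralMeasure (groupCirculant fun a => Y n a ω))
        (ν.map Complex.ofReal) ∧
      WeaklyConvergesInProbability P
        (fun n ω => empiricalSpectralMeasure (groupCirculant fun a => Y n a ω))
        (ν.map Complex.ofReal) := by
  have hlim := tendsto_average_integral_exp hG hα hβ hL2 hmean hherm hindep hcov hLind hp
    (fun s => rfl)
  simp_rw [← hν] at hlim
  have hLm : ∀ n χ, AEMeasurable (realEigenvalue (Y n) χ) (P n) := fun n χ =>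
    (memLp_realEigenvalue (hL2 n) χ).aestronglyMeasurable.aemeasurable
  let r : (ℂ →ᵇ ℝ) → (ℝ →ᵇ ℝ) := fun f => f.compContinuous ⟨Complex.ofReal, by fun_prop⟩
  have hr : ∀ f x, r f x = f x := fun _ _ => rfl
  have hint : ∀ f : ℂ →ᵇ ℝ, ∫ z, f z ∂(ν.map Complex.ofReal) = ∫ x, r f x ∂ν := fun f =>
    integral_map (by fun_prop) f.continuous.aestronglyMeasurable
  have hae : ∀ (f : ℂ →ᵇ ℝ) n, (fun ω => ∫ z, f z ∂(empiricalSpectralMeasure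
      (groupCirculant fun a => Y n a ω))) =ᵐ[P n] fun ω =>
      (Fintype.card (AddChar (Additive (G n)) ℂ) : ℝ)⁻¹ *
        ∑ χ, r f (realEigenvalue (Y n) χ ω) := by
    intro f n
    filter_upwards [ae_ofReal_realEigenvalue (hherm n)] with ω hω
    rw [integral_empiricalSpectralMeasure_groupCirculant]
    simp_rw [hr, hω]
  refine ⟨fun f => ⟨fun n => ?_, ?_⟩, fun f ε hε => ?_⟩
  · refine Integrable.congr ?_ (hae f n).symm
    refine (integrable_finsetSum _ fun χ _ => ?_).const_mul _
    exact Integrable.of_bound (C := ‖r f‖)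
      ((r f).continuous.measurable.comp_aemeasurable (hLm n χ)).aestronglyMeasurable
      (ae_of_all _ fun ω => (r f).norm_coe_le_norm _)
  · rw [hint]
    refine (tendsto_integral_of_tendsto_pair_charFun hLm hlim (r f)).congr fun n => ?_
    exact integral_congr_ae (hae f n).symm
  · rw [hint]
    refine (tendsto_measure_of_tendsto_pair_charFun hLm hlim (r f) hε).congr fun n => ?_
    refine measure_congr (Filter.eventuallyEq_set.2 ?_)
    filter_upwards [hae f n] with ω hω
    rw [hω]

end Limit

/-! ### Gaussian mixtures and the main theorem -/

theorem charFun_gaussianReal_toNNReal {v : ℝ} (hv : 0 ≤ v) (s : ℝ) :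
    charFun (gaussianReal 0 v.toNNReal) s = (Real.exp (-(s ^ 2 * v / 2)) : ℝ) := by
  rw [charFun_gaussianReal, Real.coe_toNNReal v hv]
  push_cast
  congr 1
  ring

theorem charFun_smul_add_smul {μ ν : Measure ℝ} [IsProbabilityMeasure μ] [IsProbabilityMeasure ν]
    {x y : ℝ} (hx : 0 ≤ x) (hy : 0 ≤ y) (s : ℝ) :
    charFun (ENNReal.ofReal x • μ + ENNReal.ofReal y • ν) s =
      x * charFun μ s + y * charFun ν s := by
  have hi : ∀ (μ : Measure ℝ) [IsProbabilityMeasure μ] (x : ℝ),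
      Integrable (fun u : ℝ => Complex.exp (inner ℝ u s * Complex.I)) (ENNReal.ofReal x • μ) := by
    intro μ _ x
    refine Integrable.smul_measure ?_ ENNReal.ofReal_ne_top
    exact integrable_exp_mul_I (X := fun u : ℝ => inner ℝ u s)
      (by fun_prop : Continuous fun u : ℝ => inner ℝ u s).aestronglyMeasurable
  simp only [charFun_apply]
  rw [integral_add_measure (hi μ x) (hi ν y), integral_smul_measure, integral_smul_measure,
    ENNReal.toReal_ofReal hx, ENNReal.toReal_ofReal hy, Complex.real_smul, Complex.real_smul]

theorem isProbabilityMeasure_smul_add_smul {μ ν : Measure ℝ} [IsProbabilityMeasure μ]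
    [IsProbabilityMeasure ν] {x y : ℝ} (hx : 0 ≤ x) (hy : 0 ≤ y) (hxy : x + y = 1) :
    IsProbabilityMeasure (ENNReal.ofReal x • μ + ENNReal.ofReal y • ν) := by
  refine ⟨?_⟩
  simp [← ENNReal.ofReal_add hx hy, hxy]

theorem theoremT
    {G : ℕ → Type*} [∀ n, CommGroup (G n)] [∀ n, Fintype (G n)] [∀ n, DecidableEq (G n)]
    (hG : Tendsto (fun n => Fintype.card (G n)) atTop atTop)
    {Ω : ℕ → Type*} [∀ n, MeasurableSpace (Ω n)]
    (P : ∀ n, Measure (Ω n)) [∀ n, IsProbabilityMeasure (P n)]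
    (α β : ℝ) (hα : α ∈ Set.Icc (0 : ℝ) 1) (hβ : 0 < β)
    (Y : ∀ n, G n → Ω n → ℂ)
    (hL2 : ∀ n a, MemLp (Y n a) 2 (P n))
    (hmean : ∀ n a, ∫ ω, Y n a ω ∂(P n) = 0)
    (hherm : ∀ n a, ∀ᵐ ω ∂(P n), Y n a⁻¹ ω = conj (Y n a ω))
    (hindep : ∀ n, IndepUpToInverse (P n) (Y n))
    (hcov : ∀ n a b, ∫ ω, Y n a ω * Y n b ω ∂(P n) =
      if a = b⁻¹ ∧ b⁻¹ ≠ a⁻¹ then 1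
      else if a = b ∧ b ≠ a⁻¹ then (α : ℂ)
      else if a = b ∧ b = a⁻¹ then (β : ℂ)
      else 0)
    (hLind : LindebergCondition P Y)
    (p : ℝ) (hp : Tendsto (fun n => involutionFraction (G n)) atTop (𝓝 p)) :
    (p < 1 →
      0 < 1 + p * (β - α - 1) ∧
      0 < 1 + α + p * (β - α - 1) ∧
      WeaklyConvergesInMean P
        (fun n ω => empiricalSpectralMeasure (groupCirculant fun a => Y n a ω))
        (ENNReal.ofReal (1 - p) • realNormal (1 + p * (β - α - 1)) +
          ENNReal.ofReal p • realNormal (1 + α + p * (β - α - 1))) ∧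
      WeaklyConvergesInProbability P
        (fun n ω => empiricalSpectralMeasure (groupCirculant fun a => Y n a ω))
        (ENNReal.ofReal (1 - p) • realNormal (1 + p * (β - α - 1)) +
          ENNReal.ofReal p • realNormal (1 + α + p * (β - α - 1)))) ∧
    (p = 1 →
      WeaklyConvergesInMean P
        (fun n ω => empiricalSpectralMeasure (groupCirculant fun a => Y n a ω))
        (realNormal β) ∧
      WeaklyConvergesInProbability P
        (fun n ω => empiricalSpectralMeasure (groupCirculant fun a => Y n a ω))
        (realNormal β)) := by
  have hp0 : 0 ≤ p := ge_of_tendsto' hp fun n => involutionFraction_nonneg _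
  constructor
  · intro hp1
    -- Eventually the fraction lies below 1, and the gap then puts it at or below 1/2.
    have hhalf : p ≤ 1 / 2 := by
      refine le_of_tendsto hp ?_
      filter_upwards [hp.eventually (gt_mem_nhds hp1)] with n hn
      exact (involutionFraction_eq_one_or_le_half (G n)).resolve_left hn.ne
    have hv1 : 0 < 1 + p * (β - α - 1) := by
      obtain ⟨hα0, hα1⟩ := hα
      have h1 : p * α ≤ p * 1 := mul_le_mul_of_nonneg_left hα1 hp0
      rcases hp0.eq_or_lt with h | h
      · rw [← h]; norm_num
      -- Since α ≤ 1 and p ≤ 1/2, p(α + 1) ≤ 2p ≤ 1, so the variance is at least pβ > 0.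
      · have := mul_pos h hβ
        nlinarith
    have hv2 : 0 < 1 + α + p * (β - α - 1) := by linarith [hα.1]
    have := isProbabilityMeasure_smul_add_smul
      (μ := gaussianReal 0 (1 + p * (β - α - 1)).toNNReal)
      (ν := gaussianReal 0 (1 + α + p * (β - α - 1)).toNNReal)
      (sub_nonneg.2 hp1.le) hp0 (by ring)
    have h := weaklyConverges_of_charFun hG hα.1 hβ hL2 hmean hherm hindep hcov hLind hp
      (ENNReal.ofReal (1 - p) • gaussianReal 0 (1 + p * (β - α - 1)).toNNReal +
        ENNReal.ofReal p • gaussianReal 0 (1 + α + p * (β - α - 1)).toNNReal) fun s => by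
        rw [charFun_smul_add_smul (sub_nonneg.2 hp1.le) hp0,
          charFun_gaussianReal_toNNReal hv1.le, charFun_gaussianReal_toNNReal hv2.le]
        push_cast
        simp only [mul_comm]
    rw [Measure.map_add _ _ (by fun_prop), Measure.map_smul, Measure.map_smul] at h
    exact ⟨hv1, hv2, h⟩
  · rintro rfl
    refine weaklyConverges_of_charFun hG hα.1 hβ hL2 hmean hherm hindep hcov hLind hp
      (gaussianReal 0 β.toNNReal) fun s => ?_
    -- At p = 1 the first component has weight 0 and the second has variance 1 + α + (β - α - 1) =
    -- β.
    rw [charFun_gaussianReal_toNNReal hβ.le]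
    congr 1
    ring_nf
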